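/- All graphs are finite and simple; a graph is planar if it can be drawn in the plane without crossings, and an acyclic graph has infinite girth. For an integer $k\ge 3$, a graph is $C_k$-colorable if it admits a homomorphism to the cycle $C_k$ of length $k$, and $f(k)$ denotes the smallest integer $m\ge 0$ such that every planar graph of girth exactly $k$ without cycles of length from $k+1$ to $m$ is $C_k$-colorable ($f(k)=\infty$ if there is no such $m$). For positive integers $k\ge 2d$, a circular $(k,d)$-coloring of a graph $G$ is a map $\varphi:V(G)\to\{0,1,\dots,k-1\}$ with $d\le|\varphi(u)-\varphi(v)|\le k-d$ for every edge $uv$, and the circular chromatic number $\chi_c(G)$ is the infimum of the ratios $k/d$ over all such pairs $(k,d)$ for which $G$ has a circular $(k,d)$-coloring. Let $p\ge 5$ be a prime. If $f(p)\le p(p-2)$, then every planar graph $G$ of girth at least $2p-2$ is $C_p$-colorable; in particular $\chi_c(G)\le 2+\frac{2}{p-1}$. -/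

import Mathlib

namespace SteinbergCircular

/-- `A` is a simple polygonal arc in the plane from `x` to `y`: a chain of `n ≥ 1` nondegenerate
straight segments `[q 0, q 1], …, [q (n-1), q n]` with `q 0 = x`, `q n = y`, in which consecutive
segments meet only in their common end and other pairs of segments are disjoint. -/
def IsPolygonalArc (A : Set (ℝ × ℝ)) (x y : ℝ × ℝ) : Prop :=
  ∃ (n : ℕ) (q : ℕ → ℝ × ℝ),
    0 < n ∧ q 0 = x ∧ q n = y ∧
    A = ⋃ i ∈ Finset.range n, segment ℝ (q i) (q (i + 1)) ∧
    (∀ i, i < n → q i ≠ q (i + 1)) ∧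
    (∀ i, i + 1 < n →
      segment ℝ (q i) (q (i + 1)) ∩ segment ℝ (q (i + 1)) (q (i + 2)) = {q (i + 1)}) ∧
    (∀ i j, i + 1 < j → j < n →
      Disjoint (segment ℝ (q i) (q (i + 1))) (segment ℝ (q j) (q (j + 1))))

/-- A drawing of `G` in the plane without crossings: vertices are distinct points, every edge is a
simple polygonal arc joining its two ends and passing through no other vertex, and
two different edges meet only in common ends. -/
structure PlaneDrawing {V : Type*} (G : SimpleGraph V) where
  /-- the point that represents a vertex -/
  pt : V → ℝ × ℝ
  /-- the arc that represents an edge (irrelevant on pairs that are not edges) -/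
  arc : Sym2 V → Set (ℝ × ℝ)
  pt_injective : Function.Injective pt
  isPolygonalArc : ∀ u v, G.Adj u v → IsPolygonalArc (arc s(u, v)) (pt u) (pt v)
  mem_of_pt_mem : ∀ e ∈ G.edgeSet, ∀ w, pt w ∈ arc e → w ∈ e
  inter_subset : ∀ e ∈ G.edgeSet, ∀ f ∈ G.edgeSet, e ≠ f →
    ∀ z ∈ arc e ∩ arc f, ∃ w, w ∈ e ∧ w ∈ f ∧ pt w = z

/-- A graph is planar if it can be drawn in the plane without crossings. -/
def IsPlanar {V : Type*} (G : SimpleGraph V) : Prop :=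
  Nonempty (PlaneDrawing G)

/-- `G` is `C_k`-colorable: it admits a homomorphism to the cycle of length `k`. -/
def CycleColorable {V : Type*} (G : SimpleGraph V) (k : ℕ) : Prop :=
  Nonempty (G →g SimpleGraph.cycleGraph k)

/-- `G` has no cycle whose length lies in `{a, a + 1, …, b}`. -/
def NoCycleOfLength {V : Type*} (G : SimpleGraph V) (a b : ℕ) : Prop :=
  ∀ (v : V) (c : G.Walk v v), c.IsCycle → ¬ (a ≤ c.length ∧ c.length ≤ b)

/-- Every finite planar graph of girth `k` without cycles of length from `k + 1` to `m` is
`C_k`-colorable. -/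
def IsSteinbergBound (k m : ℕ) : Prop :=
  ∀ (V : Type) [Finite V] (G : SimpleGraph V), IsPlanar G → G.egirth = (k : ℕ∞) →
    NoCycleOfLength G (k + 1) m → CycleColorable G k

/-- `f k` is the smallest `m` such that every finite planar graph of girth `k` without cycles of
length from `k + 1` to `m` is `C_k`-colorable, and `⊤` if there is no such `m`. -/
noncomputable def f (k : ℕ) : ℕ∞ :=
  ⨅ (m : ℕ) (_ : IsSteinbergBound k m), (m : ℕ∞)

/-- `G` has a circular `(k, d)`-coloring. -/
def HasCircularColoring {V : Type*} (G : SimpleGraph V) (k d : ℕ) : Prop :=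
  ∃ φ : V → Fin k, ∀ u v, G.Adj u v →
    (d : ℤ) ≤ |(φ u : ℤ) - (φ v : ℤ)| ∧ |(φ u : ℤ) - (φ v : ℤ)| ≤ (k : ℤ) - (d : ℤ)

/-- The circular chromatic number: the infimum of the ratios `k / d` over all positive integers
`k ≥ 2 d` for which `G` has a circular `(k, d)`-coloring. -/
noncomputable def circularChromaticNumber {V : Type*} (G : SimpleGraph V) : ℝ :=
  sInf {r : ℝ | ∃ k d : ℕ, 0 < d ∧ 2 * d ≤ k ∧ HasCircularColoring G k d ∧ r = (k : ℝ) / (d : ℝ)}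

end SteinbergCircular

/-!
Write `p = 2a + 1` and replace every edge of `G` by a cycle of length `p` on which the ends of the
edge are at distance `a`, that is, by two parallel paths of lengths `a` and `a + 1`. The new graph
is planar, because a polygonal arc can be doubled by shifting its inner vertices slightly to the
left, and arcs can be subdivided. A cycle of the new graph is either one of the inserted
`p`-cycles, or the edges of `G` that it runs along contain a cycle of `G`, and then its length is
at least `a * (2p - 2) = (p - 1)² > p (p - 2)`. So the hypothesis on `f p` yields a
`C_p`-colouring of the new graph. In it the colours of the ends of an edge of `G` are joined by
walks of lengths `a` and `a + 1` in `C_p`, hence differ by `±a`; since `-2a = 1` modulo `p`,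
multiplication by `-2` turns them into a `C_p`-colouring of `G`. Multiplying a `C_p`-colouring by
`a` gives a circular `(p, a)`-colouring. Infinite graphs are reached by compactness.
-/

namespace SteinbergCircular

open Filter Topology

lemma eventually_ne_of_tendsto {ι X : Type*} [TopologicalSpace X] [T2Space X] {l : Filter ι}
    {a b : ι → X} {a₀ b₀ : X} (ha : Tendsto a l (𝓝 a₀)) (hb : Tendsto b l (𝓝 b₀))
    (h : a₀ ≠ b₀) : ∀ᶠ i in l, a i ≠ b i :=
  (ha.prodMk_nhds hb).eventually ((isOpen_ne_fun continuous_fst continuous_snd).mem_nhds h)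

section Segments

variable {E : Type*} [AddCommGroup E] [Module ℝ E]

lemma segment_union_segment_of_mem {a b m : E} (hm : m ∈ segment ℝ a b) :
    segment ℝ a m ∪ segment ℝ m b = segment ℝ a b := by
  have hconv := convex_segment (𝕜 := ℝ) a b
  refine subset_antisymm (Set.union_subset (hconv.segment_subset (left_mem_segment ℝ a b) hm)
    (hconv.segment_subset hm (right_mem_segment ℝ a b))) fun z hz => ?_
  obtain rfl | hab := eq_or_ne a b
  · simp_all only [segment_same, Set.mem_singleton_iff, Set.union_self]
  simp only [Set.mem_union, mem_segment_iff_wbtw] at hm hz ⊢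
  have hray : SameRay ℝ (z -ᵥ a) (m -ᵥ a) := hz.sameRay_vsub_left.trans hm.sameRay_vsub_left.symm
    fun h => absurd (vsub_eq_zero_iff_eq.1 h).symm hab
  exact (wbtw_total_of_sameRay_vsub_left hray).imp_right hz.trans_left_right

lemma segment_inter_segment_of_mem {a b m : E} (hm : m ∈ segment ℝ a b) :
    segment ℝ a m ∩ segment ℝ m b ⊆ {m} := by
  rintro z ⟨hz, hz'⟩
  rw [mem_segment_iff_wbtw] at hm hz hz'
  exact (wbtw_swap_right_iff ℝ a).1 ⟨hz, hm.trans_right_left hz'⟩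

lemma segment_inter_segment_subset_iff {a b c : E} (hab : a ≠ b) (hac : a ≠ c) :
    segment ℝ a b ∩ segment ℝ a c ⊆ {a} ↔ ¬ SameRay ℝ (b - a) (c - a) := by
  refine ⟨fun h hray => ?_, fun h z ⟨hb, hc⟩ => by_contra fun hza => h ?_⟩
  · rcases wbtw_total_of_sameRay_vsub_left (P := E) hray with hb | hc
    · exact hab (h ⟨right_mem_segment ℝ a b, mem_segment_iff_wbtw.2 hb⟩).symm
    · exact hac (h ⟨mem_segment_iff_wbtw.2 hc, right_mem_segment ℝ a c⟩).symm
  · exact (mem_segment_iff_wbtw.1 hb).sameRay_vsub_left.symm.trans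
      (mem_segment_iff_wbtw.1 hc).sameRay_vsub_left fun h0 => absurd (sub_eq_zero.1 h0) hza

end Segments

section Perturbation

variable {E : Type*} [NormedAddCommGroup E] [NormedSpace ℝ E]

lemma isCompact_segment (a b : E) : IsCompact (segment ℝ a b) := by
  rw [segment_eq_image_lineMap]
  exact isCompact_Icc.image AffineMap.lineMap_continuous

variable {ι : Type*} {l : Filter ι} {a b c d : ι → E} {a₀ b₀ c₀ d₀ : E}

lemma eventually_disjoint_segment (ha : Tendsto a l (𝓝 a₀)) (hb : Tendsto b l (𝓝 b₀))
    (hc : Tendsto c l (𝓝 c₀)) (hd : Tendsto d l (𝓝 d₀))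
    (h : Disjoint (segment ℝ a₀ b₀) (segment ℝ c₀ d₀)) :
    ∀ᶠ i in l, Disjoint (segment ℝ (a i) (b i)) (segment ℝ (c i) (d i)) := by
  obtain ⟨φ, u, v, hu, huv, hv⟩ := geometric_hahn_banach_compact_closed (convex_segment a₀ b₀)
    (isCompact_segment a₀ b₀) (convex_segment c₀ d₀) (isCompact_segment c₀ d₀).isClosed h
  have map {x : ι → E} {x₀ : E} (hx : Tendsto x l (𝓝 x₀)) :
      Tendsto (fun i => φ (x i)) l (𝓝 (φ x₀)) := (φ.continuous.tendsto x₀).comp hx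
  filter_upwards [(map ha).eventually_lt_const (hu _ (left_mem_segment ℝ a₀ b₀)),
    (map hb).eventually_lt_const (hu _ (right_mem_segment ℝ a₀ b₀)),
    (map hc).eventually_const_lt (hv _ (left_mem_segment ℝ c₀ d₀)),
    (map hd).eventually_const_lt (hv _ (right_mem_segment ℝ c₀ d₀))] with i hai hbi hci hdi
  refine Set.disjoint_left.2 fun z hz hz' => ?_
  have hzu : φ z < u :=
    (convex_halfSpace_lt φ.toLinearMap.isLinear u).segment_subset hai hbi hz
  have hzv : v < φ z :=
    (convex_halfSpace_gt φ.toLinearMap.isLinear v).segment_subset hci hdi hz'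
  exact (hzu.trans huv).asymm hzv

lemma eventually_segment_inter_segment_subset (ha : Tendsto a l (𝓝 a₀))
    (hb : Tendsto b l (𝓝 b₀)) (hc : Tendsto c l (𝓝 c₀)) (hab : a₀ ≠ b₀) (hac : a₀ ≠ c₀)
    (h : segment ℝ a₀ b₀ ∩ segment ℝ a₀ c₀ ⊆ {a₀}) :
    ∀ᶠ i in l, segment ℝ (a i) (b i) ∩ segment ℝ (a i) (c i) ⊆ {a i} := by
  rw [segment_inter_segment_subset_iff hab hac, sameRay_iff_norm_smul_eq] at h
  have hba := hb.sub ha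
  have hca := hc.sub ha
  filter_upwards [((hba.norm.smul hca).sub (hca.norm.smul hba)).eventually_ne (sub_ne_zero.2 h),
    eventually_ne_of_tendsto ha hb hab, eventually_ne_of_tendsto ha hc hac] with i hi hbi hci
  rwa [segment_inter_segment_subset_iff hbi hci, sameRay_iff_norm_smul_eq, ← sub_eq_zero]

end Perturbation

section Polyline

variable {E : Type*} [AddCommGroup E] [Module ℝ E] {q : ℕ → E} {n : ℕ}

/-- The `i`-th segment of the polygonal line with vertices `q 0, q 1, …`. -/
def seg (q : ℕ → E) (i : ℕ) : Set E := segment ℝ (q i) (q (i + 1))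

/-- The part from `q s` to `q t` of the polygonal line with vertices `q 0, q 1, …`. -/
def polyline (q : ℕ → E) (s t : ℕ) : Set E := ⋃ k ∈ Finset.Ico s t, seg q k

/-- The polygonal line with vertices `q 0, …, q n` is simple. The two cases of `IsPolygonalArc`,
consecutive segments and segments further apart, are merged in the field `meet`. -/
structure IsSimplePolyline (n : ℕ) (q : ℕ → E) : Prop where
  ne : ∀ i < n, q i ≠ q (i + 1)
  meet : ∀ {i j : ℕ} {z : E}, i < j → j < n → z ∈ seg q i → z ∈ seg q j → j = i + 1 ∧ z = q j

lemma left_mem_seg (q : ℕ → E) (i : ℕ) : q i ∈ seg q i := left_mem_segment ℝ _ _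

lemma right_mem_seg (q : ℕ → E) (i : ℕ) : q (i + 1) ∈ seg q i := right_mem_segment ℝ _ _

lemma mem_polyline {s t : ℕ} {z : E} : z ∈ polyline q s t ↔ ∃ k, s ≤ k ∧ k < t ∧ z ∈ seg q k := by
  simp only [polyline, Finset.mem_Ico, Set.mem_iUnion, exists_prop, and_assoc]

lemma seg_subset_polyline {s t k : ℕ} (hs : s ≤ k) (ht : k < t) : seg q k ⊆ polyline q s t :=
  fun _ hz => mem_polyline.2 ⟨k, hs, ht, hz⟩

lemma polyline_mono {s t s' t' : ℕ} (hs : s' ≤ s) (ht : t ≤ t') :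
    polyline q s t ⊆ polyline q s' t' :=
  Set.biUnion_subset_biUnion_left (Finset.Ico_subset_Ico hs ht)

lemma seg_reverse (q : ℕ → E) {i : ℕ} (hi : i < n) :
    seg (fun k => q (n - k)) i = seg q (n - (i + 1)) := by
  rw [seg, seg, segment_symm, show n - (i + 1) + 1 = n - i by omega]

lemma polyline_reverse : polyline (fun k => q (n - k)) 0 n = polyline q 0 n := by
  ext z
  simp only [mem_polyline]
  constructor
  · rintro ⟨k, -, hk, hz⟩
    exact ⟨n - (k + 1), by omega, by omega, seg_reverse q hk ▸ hz⟩
  · rintro ⟨k, -, hk, hz⟩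
    refine ⟨n - (k + 1), by omega, by omega, ?_⟩
    rwa [seg_reverse q (by omega), show n - (n - (k + 1) + 1) = k by omega]

namespace IsSimplePolyline

lemma eq_or_eq_of_mem_seg (hq : IsSimplePolyline n q) {k i : ℕ} (hk : k ≤ n) (hi : i < n)
    (h : q k ∈ seg q i) : k = i ∨ k = i + 1 := by
  rcases hk.lt_or_eq with hk | rfl
  · rcases lt_trichotomy i k with hik | rfl | hik
    · exact Or.inr (hq.meet hik hk h (left_mem_seg q k)).1
    · exact Or.inl rfl
    · obtain ⟨rfl, hki⟩ := hq.meet hik hi (left_mem_seg q k) h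
      exact absurd hki (hq.ne k hk)
  · obtain ⟨m, rfl⟩ : ∃ m, k = m + 1 := ⟨k - 1, by omega⟩
    rcases (Nat.lt_succ_iff.1 hi).lt_or_eq with him | rfl
    · exact absurd (hq.meet him (by omega) h (right_mem_seg q m)).2.symm (hq.ne m (by omega))
    · exact Or.inr rfl

lemma vertex_inj (hq : IsSimplePolyline n q) {k k' : ℕ} (hk : k ≤ n) (hk' : k' ≤ n)
    (h : q k = q k') : k = k' := by
  by_contra hne
  wlog hlt : k < k' generalizing k k'
  · exact this hk' hk h.symm (Ne.symm hne) (by omega)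
  rcases hq.eq_or_eq_of_mem_seg hk' (i := k) (by omega) (h ▸ left_mem_seg q k) with rfl | rfl
  · exact hne rfl
  · exact hq.ne k (by omega) h

lemma vertex_mem_polyline (hq : IsSimplePolyline n q) {s t k : ℕ} (hk : k ≤ n) (ht : t ≤ n)
    (h : q k ∈ polyline q s t) : s ≤ k ∧ k ≤ t := by
  obtain ⟨i, hsi, hit, hki⟩ := mem_polyline.1 h
  have := hq.eq_or_eq_of_mem_seg hk (hit.trans_le ht) hki
  omega

lemma polyline_inter (hq : IsSimplePolyline n q) {s t s' t' : ℕ} (hts : t ≤ s') (ht' : t' ≤ n)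
    {z : E} (hz : z ∈ polyline q s t) (hz' : z ∈ polyline q s' t') : s' = t ∧ z = q t := by
  obtain ⟨i, -, hit, hi⟩ := mem_polyline.1 hz
  obtain ⟨j, hsj, hjt, hj⟩ := mem_polyline.1 hz'
  obtain ⟨rfl, rfl⟩ := hq.meet (by omega) (by omega) hi hj
  obtain rfl : t = i + 1 := by omega
  exact ⟨by omega, rfl⟩

lemma shift (hq : IsSimplePolyline n q) {s m : ℕ} (h : s + m ≤ n) :
    IsSimplePolyline m fun i => q (s + i) where
  ne i hi := hq.ne (s + i) (by omega)
  meet {i j z} hij hj hi hj' := by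
    obtain ⟨hji, rfl⟩ := hq.meet (i := s + i) (j := s + j) (by omega) (by omega) hi hj'
    exact ⟨by omega, rfl⟩

lemma reverse (hq : IsSimplePolyline n q) : IsSimplePolyline n fun i => q (n - i) where
  ne i hi := by
    have := (hq.ne (n - (i + 1)) (by omega)).symm
    rwa [show n - (i + 1) + 1 = n - i by omega] at this
  meet {i j z} hij hj hzi hzj := by
    rw [seg_reverse q (by omega)] at hzi hzj
    obtain ⟨h, rfl⟩ := hq.meet (by omega) (by omega) hzj hzi
    obtain rfl : j = i + 1 := by omega
    exact ⟨rfl, rfl⟩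

end IsSimplePolyline

/-- Inserts the midpoint of the first segment as a new vertex. -/
noncomputable def splitFirst (q : ℕ → E) : ℕ → E
  | 0 => q 0
  | 1 => midpoint ℝ (q 0) (q 1)
  | k + 2 => q (k + 1)

lemma seg_splitFirst_zero_union_one (q : ℕ → E) :
    seg (splitFirst q) 0 ∪ seg (splitFirst q) 1 = seg q 0 :=
  segment_union_segment_of_mem (midpoint_mem_segment (q 0) (q 1))

lemma polyline_splitFirst (hn : 0 < n) : polyline (splitFirst q) 0 (n + 1) = polyline q 0 n := by
  ext z
  have h01 : z ∈ seg q 0 ↔ z ∈ seg (splitFirst q) 0 ∨ z ∈ seg (splitFirst q) 1 := by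
    rw [← seg_splitFirst_zero_union_one, Set.mem_union]
  simp only [mem_polyline, Nat.zero_le, true_and]
  constructor
  · rintro ⟨_ | _ | k, hk, hz⟩
    · exact ⟨0, hn, h01.2 (Or.inl hz)⟩
    · exact ⟨0, hn, h01.2 (Or.inr hz)⟩
    · exact ⟨k + 1, by omega, hz⟩
  · rintro ⟨_ | k, hk, hz⟩
    · rcases h01.1 hz with hz | hz
      · exact ⟨0, by omega, hz⟩
      · exact ⟨1, by omega, hz⟩
    · exact ⟨k + 2, by omega, hz⟩

lemma isSimplePolyline_splitFirst (hn : 0 < n) (hq : IsSimplePolyline n q) :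
    IsSimplePolyline (n + 1) (splitFirst q) := by
  have hleft : seg (splitFirst q) 0 ⊆ seg q 0 :=
    seg_splitFirst_zero_union_one q ▸ Set.subset_union_left
  have hright : seg (splitFirst q) 1 ⊆ seg q 0 :=
    seg_splitFirst_zero_union_one q ▸ Set.subset_union_right
  have hinter {z : E} (h0 : z ∈ seg (splitFirst q) 0)
      (h1 : z ∈ seg (splitFirst q) 1) : z = midpoint ℝ (q 0) (q 1) :=
    segment_inter_segment_of_mem (midpoint_mem_segment (q 0) (q 1)) ⟨h0, h1⟩
  have hne0 : q 0 ≠ midpoint ℝ (q 0) (q 1) := (sbtw_midpoint_of_ne ℝ (hq.ne 0 hn)).left_ne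
  have hne1 : midpoint ℝ (q 0) (q 1) ≠ q 1 := (sbtw_midpoint_of_ne ℝ (hq.ne 0 hn)).ne_right
  refine ⟨?_, ?_⟩
  · rintro (_ | _ | k) hk
    exacts [hne0, hne1, hq.ne (k + 1) (by omega)]
  · rintro (_ | _ | i) (_ | _ | j) z hij hj hzi hzj
    any_goals omega
    · exact ⟨rfl, hinter hzi hzj⟩
    · obtain ⟨h, rfl⟩ := hq.meet (j := j + 1) j.succ_pos (by omega) (hleft hzi) hzj
      obtain rfl : j = 0 := by omega
      exact absurd (hinter hzi (right_mem_seg (splitFirst q) 1)).symm hne1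
    · obtain ⟨h, rfl⟩ := hq.meet (j := j + 1) j.succ_pos (by omega) (hright hzi) hzj
      exact ⟨by omega, rfl⟩
    · obtain ⟨h, rfl⟩ := hq.meet (by omega) (by omega) hzi hzj
      exact ⟨by omega, rfl⟩

lemma IsSimplePolyline.exists_le_card (hn : 0 < n) (hq : IsSimplePolyline n q) (M : ℕ) :
    ∃ (m : ℕ) (r : ℕ → E), IsSimplePolyline m r ∧ 0 < m ∧ M ≤ m ∧ r 0 = q 0 ∧ r m = q n ∧
      polyline r 0 m = polyline q 0 n := by
  induction M with
  | zero => exact ⟨n, q, hq, hn, n.zero_le, rfl, rfl, rfl⟩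
  | succ M ih =>
    obtain ⟨m, r, hr, hm, hM, h0, hrm, hrq⟩ := ih
    refine ⟨m + 1, splitFirst r, isSimplePolyline_splitFirst hm hr, m.succ_pos,
      Nat.succ_le_succ hM, h0, ?_, (polyline_splitFirst hm).trans hrq⟩
    obtain ⟨m, rfl⟩ := Nat.exists_eq_add_one_of_ne_zero hm.ne'
    exact hrm

end Polyline

section Arcs

lemma IsSimplePolyline.isPolygonalArc {n s t : ℕ} {q : ℕ → ℝ × ℝ} (hq : IsSimplePolyline n q)
    (hst : s < t) (ht : t ≤ n) : IsPolygonalArc (polyline q s t) (q s) (q t) := by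
  have hshift : IsSimplePolyline (t - s) fun i => q (s + i) := hq.shift (by omega)
  refine ⟨t - s, fun i => q (s + i), by omega, rfl, congrArg q (by omega), ?_, hshift.ne,
    fun i hi => ?_, fun i j hij hj => ?_⟩
  · ext z
    simp only [mem_polyline, Set.mem_iUnion, Finset.mem_range, exists_prop]
    exact ⟨fun ⟨k, hsk, hkt, hz⟩ => ⟨k - s, by omega, by
        rwa [← add_assoc, Nat.add_sub_cancel' hsk]⟩,
      fun ⟨i, hi, hz⟩ => ⟨s + i, by omega, by omega, hz⟩⟩
  · exact subset_antisymm (fun z hz => (hshift.meet i.lt_succ_self hi hz.1 hz.2).2)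
      (Set.singleton_subset_iff.2 ⟨right_mem_segment ℝ _ _, left_mem_segment ℝ _ _⟩)
  · exact Set.disjoint_left.2 fun z hi hj' =>
      hij.ne' (hshift.meet (by omega) hj hi hj').1

lemma IsPolygonalArc.exists_isSimplePolyline {A : Set (ℝ × ℝ)} {x y : ℝ × ℝ}
    (h : IsPolygonalArc A x y) : ∃ (n : ℕ) (q : ℕ → ℝ × ℝ), IsSimplePolyline n q ∧ 0 < n ∧
      q 0 = x ∧ q n = y ∧ polyline q 0 n = A := by
  obtain ⟨n, q, hn, h0, hqn, rfl, hne, hcons, hdisj⟩ := h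
  refine ⟨n, q, ⟨hne, fun {i j z} hij hj hi hj' => ?_⟩, hn, h0, hqn, by
    rw [polyline, ← Finset.range_eq_Ico]; rfl⟩
  obtain rfl | hij := (Nat.succ_le_iff.2 hij).eq_or_lt
  · exact ⟨rfl, (hcons i hj).subset ⟨hi, hj'⟩⟩
  · exact absurd hj' (Set.disjoint_left.1 (hdisj i j hij hj) hi)

lemma IsPolygonalArc.symm {A : Set (ℝ × ℝ)} {x y : ℝ × ℝ} (h : IsPolygonalArc A x y) :
    IsPolygonalArc A y x := by
  obtain ⟨n, q, hq, hn, rfl, rfl, rfl⟩ := h.exists_isSimplePolyline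
  simpa [polyline_reverse] using hq.reverse.isPolygonalArc hn le_rfl

end Arcs

section PolylinePerturbation

variable {E ι : Type*} [NormedAddCommGroup E] [NormedSpace ℝ E] {l : Filter ι} {n n' : ℕ}
  {q q' : ℕ → E} {r r' : ι → ℕ → E}

lemma eventually_forall_lt {p : ℕ → ι → Prop} (h : ∀ i < n, ∀ᶠ t in l, p i t) :
    ∀ᶠ t in l, ∀ i < n, p i t :=
  (eventually_all_finite (Set.finite_Iio n)).2 h

lemma eventually_disjoint_seg (hr : Tendsto r l (𝓝 q)) (hr' : Tendsto r' l (𝓝 q')) {i j : ℕ}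
    (h : Disjoint (seg q i) (seg q' j)) : ∀ᶠ t in l, Disjoint (seg (r t) i) (seg (r' t) j) :=
  eventually_disjoint_segment (hr.apply_nhds i) (hr.apply_nhds (i + 1)) (hr'.apply_nhds j)
    (hr'.apply_nhds (j + 1)) h

lemma eventually_notMem_polyline (hr : Tendsto r l (𝓝 q)) {x : E}
    (hx : x ∉ polyline q 0 n) : ∀ᶠ t in l, x ∉ polyline (r t) 0 n := by
  have hseg : ∀ᶠ t in l, ∀ i < n, x ∉ seg (r t) i := by
    refine eventually_forall_lt fun i hi => ?_
    have hdisj : Disjoint (segment ℝ x x) (seg q i) := by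
      rw [segment_same, Set.disjoint_singleton_left]
      exact fun h => hx (seg_subset_polyline i.zero_le hi h)
    filter_upwards [eventually_disjoint_segment tendsto_const_nhds tendsto_const_nhds
      (hr.apply_nhds i) (hr.apply_nhds (i + 1)) hdisj] with t ht
    rwa [segment_same, Set.disjoint_singleton_left] at ht
  filter_upwards [hseg] with t ht h
  obtain ⟨i, -, hi, hxi⟩ := mem_polyline.1 h
  exact ht i hi hxi

namespace IsSimplePolyline

lemma eventually_ne (hq : IsSimplePolyline n q) (hr : Tendsto r l (𝓝 q)) :
    ∀ᶠ t in l, ∀ i < n, r t i ≠ r t (i + 1) :=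
  eventually_forall_lt fun i hi =>
    eventually_ne_of_tendsto (hr.apply_nhds i) (hr.apply_nhds (i + 1)) (hq.ne i hi)

lemma eventually_consecutive (hq : IsSimplePolyline n q) (hr : Tendsto r l (𝓝 q)) {i : ℕ}
    (hi : i + 1 < n) : ∀ᶠ t in l, seg (r t) i ∩ seg (r t) (i + 1) ⊆ {r t (i + 1)} := by
  have hcorner : segment ℝ (q (i + 1)) (q i) ∩ segment ℝ (q (i + 1)) (q (i + 2)) ⊆ {q (i + 1)} :=
    fun z ⟨hz, hz'⟩ => (hq.meet i.lt_succ_self hi ((segment_symm ℝ _ _).subset hz) hz').2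
  filter_upwards [eventually_segment_inter_segment_subset (hr.apply_nhds (i + 1)) (hr.apply_nhds i)
    (hr.apply_nhds (i + 2)) (hq.ne i (by omega)).symm (hq.ne (i + 1) hi) hcorner] with t ht
  rwa [seg, segment_symm]

protected lemma eventually (hq : IsSimplePolyline n q) (hr : Tendsto r l (𝓝 q)) :
    ∀ᶠ t in l, IsSimplePolyline n (r t) := by
  have hmeet : ∀ᶠ t in l, ∀ j < n, ∀ i < j, ∀ z, z ∈ seg (r t) i → z ∈ seg (r t) j →
      j = i + 1 ∧ z = r t j := by
    refine eventually_forall_lt fun j hj => eventually_forall_lt fun i hi => ?_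
    obtain rfl | hij := (Nat.succ_le_iff.2 hi).eq_or_lt
    · filter_upwards [hq.eventually_consecutive hr hj] with t ht z hzi hzj
      exact ⟨rfl, ht ⟨hzi, hzj⟩⟩
    · have hdisj : Disjoint (seg q i) (seg q j) :=
        Set.disjoint_left.2 fun z hzi hzj => hij.ne' (hq.meet hi hj hzi hzj).1
      filter_upwards [eventually_disjoint_seg hr hr hdisj] with t ht z hzi hzj
      exact absurd hzj (Set.disjoint_left.1 ht hzi)
  filter_upwards [hq.eventually_ne hr, hmeet] with t hne hmeet
  exact ⟨hne, fun hij hj => hmeet _ hj _ hij _⟩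

lemma exists_forall_seg_eq (hq : IsSimplePolyline n q) {z : E} (hz : z ∈ ({q 0, q n} : Set E))
    {i : ℕ} (hi : i < n) (hzi : z ∈ seg q i) :
    ∃ k, z ≠ q k ∧ ∀ r : ℕ → E, r 0 = q 0 → r n = q n → seg r i = segment ℝ z (r k) := by
  obtain rfl | rfl := hz
  · obtain rfl | h := hq.eq_or_eq_of_mem_seg n.zero_le hi hzi
    · exact ⟨1, hq.ne 0 hi, fun r h0 _ => by rw [← h0]; rfl⟩
    · omega
  · obtain h | rfl := hq.eq_or_eq_of_mem_seg le_rfl hi hzi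
    · omega
    · exact ⟨i, (hq.ne i hi).symm, fun r _ hn => by rw [← hn]; exact segment_symm ℝ _ _⟩

lemma eq_of_mem_seg_of_mem_ends (hq : IsSimplePolyline n q) (hn : 2 ≤ n) {y z : E}
    (hy : y ∈ ({q 0, q n} : Set E)) (hz : z ∈ ({q 0, q n} : Set E)) {i : ℕ} (hi : i < n)
    (hyi : y ∈ seg q i) (hzi : z ∈ seg q i) : y = z := by
  obtain rfl | rfl := hy <;> obtain rfl | rfl := hz
  · rfl
  · have := hq.eq_or_eq_of_mem_seg n.zero_le hi hyi
    have := hq.eq_or_eq_of_mem_seg le_rfl hi hzi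
    omega
  · have := hq.eq_or_eq_of_mem_seg le_rfl hi hyi
    have := hq.eq_or_eq_of_mem_seg n.zero_le hi hzi
    omega
  · rfl

/- A segment of a simple line with at least two segments has at most one end of the line on it, so
two segments that meet do so in one common end, which the perturbation fixes. -/
lemma eventually_inter_subset (hq : IsSimplePolyline n q) (hq' : IsSimplePolyline n' q')
    (hn : 2 ≤ n) (hr : Tendsto r l (𝓝 q)) (hr' : Tendsto r' l (𝓝 q'))
    (hr0 : ∀ t, r t 0 = q 0) (hrn : ∀ t, r t n = q n)
    (hr0' : ∀ t, r' t 0 = q' 0) (hrn' : ∀ t, r' t n' = q' n') {C : Set E}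
    (hC : C ⊆ {q 0, q n}) (hC' : C ⊆ {q' 0, q' n'})
    (h : polyline q 0 n ∩ polyline q' 0 n' ⊆ C) :
    ∀ᶠ t in l, polyline (r t) 0 n ∩ polyline (r' t) 0 n' ⊆ C := by
  have hseg : ∀ᶠ t in l, ∀ i < n, ∀ j < n', seg (r t) i ∩ seg (r' t) j ⊆ C := by
    refine eventually_forall_lt fun i hi => eventually_forall_lt fun j hj => ?_
    have hij : seg q i ∩ seg q' j ⊆ C := (Set.inter_subset_inter
      (seg_subset_polyline i.zero_le hi) (seg_subset_polyline j.zero_le hj)).trans h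
    by_cases hd : Disjoint (seg q i) (seg q' j)
    · filter_upwards [eventually_disjoint_seg hr hr' hd] with t ht
      simp only [ht.inter_eq, Set.empty_subset]
    obtain ⟨z, hzi, hzj⟩ := Set.not_disjoint_iff.1 hd
    have hz : z ∈ C := hij ⟨hzi, hzj⟩
    obtain ⟨k, hzk, hk⟩ := hq.exists_forall_seg_eq (hC hz) hi hzi
    obtain ⟨k', hzk', hk'⟩ := hq'.exists_forall_seg_eq (hC' hz) hj hzj
    have honly : segment ℝ z (q k) ∩ segment ℝ z (q' k') ⊆ {z} := by
      rw [← hk q rfl rfl, ← hk' q' rfl rfl]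
      exact fun y hy => hq.eq_of_mem_seg_of_mem_ends hn (hC (hij hy)) (hC hz) hi hy.1 hzi
    filter_upwards [eventually_segment_inter_segment_subset tendsto_const_nhds (hr.apply_nhds k)
      (hr'.apply_nhds k') hzk hzk' honly] with t ht
    rw [hk _ (hr0 t) (hrn t), hk' _ (hr0' t) (hrn' t)]
    exact ht.trans (Set.singleton_subset_iff.2 hz)
  filter_upwards [hseg] with t ht z ⟨hz, hz'⟩
  obtain ⟨i, -, hi, hzi⟩ := mem_polyline.1 hz
  obtain ⟨j, -, hj, hzj⟩ := mem_polyline.1 hz'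
  exact ht i hi j hj ⟨hzi, hzj⟩

end IsSimplePolyline

end PolylinePerturbation

section LeftShift

/-- The two-dimensional cross product, positive when `v` points to the left of `u`. -/
def cross : (ℝ × ℝ) →ₗ[ℝ] (ℝ × ℝ) →ₗ[ℝ] ℝ :=
  LinearMap.mk₂ ℝ (fun u v => u.1 * v.2 - u.2 * v.1)
    (fun u u' v => by simp only [Prod.fst_add, Prod.snd_add]; ring)
    (fun c u v => by simp only [Prod.smul_fst, Prod.smul_snd, smul_eq_mul]; ring)
    (fun u v v' => by simp only [Prod.fst_add, Prod.snd_add]; ring)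
    (fun c u v => by simp only [Prod.smul_fst, Prod.smul_snd, smul_eq_mul]; ring)

lemma cross_apply (u v : ℝ × ℝ) : cross u v = u.1 * v.2 - u.2 * v.1 := rfl

lemma cross_self (u : ℝ × ℝ) : cross u u = 0 := by rw [cross_apply, mul_comm, sub_self]

lemma exists_cross_eq (φ : (ℝ × ℝ) →ₗ[ℝ] ℝ) : ∃ w, ∀ u, cross u w = φ u := by
  refine ⟨(-φ (0, 1), φ (1, 0)), fun u => ?_⟩
  have hu : u = u.1 • (1, 0) + u.2 • (0, 1) := by ext <;> simp
  conv_rhs => rw [hu, map_add, map_smul, map_smul, smul_eq_mul, smul_eq_mul]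
  rw [cross_apply, mul_neg, sub_neg_eq_add]

lemma exists_cross_pos {u v : ℝ × ℝ} (h : ¬ SameRay ℝ (-u) v) :
    ∃ w, 0 < cross u w ∧ 0 < cross v w := by
  have h0 : (0 : ℝ × ℝ) ∉ segment ℝ u v := by
    rwa [mem_segment_iff_sameRay, zero_sub, sub_zero]
  obtain ⟨φ, c, hc, hφ⟩ := geometric_hahn_banach_point_closed (convex_segment u v)
    (isCompact_segment u v).isClosed h0
  rw [map_zero] at hc
  obtain ⟨w, hw⟩ := exists_cross_eq φ.toLinearMap
  exact ⟨w, (hw u).symm ▸ hc.trans (hφ u (left_mem_segment ℝ u v)),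
    (hw v).symm ▸ hc.trans (hφ v (right_mem_segment ℝ u v))⟩

/-- The affine function that is positive to the left of the `i`-th segment of a polygonal line. -/
def side (q : ℕ → ℝ × ℝ) (i : ℕ) : (ℝ × ℝ) →ᵃ[ℝ] ℝ :=
  (cross (q (i + 1) - q i)).toAffineMap -
    AffineMap.const ℝ (ℝ × ℝ) (cross (q (i + 1) - q i) (q i))

variable {q w : ℕ → ℝ × ℝ} {n i : ℕ} {t : ℝ} {z : ℝ × ℝ}

lemma side_apply (q : ℕ → ℝ × ℝ) (i : ℕ) (z : ℝ × ℝ) :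
    side q i z = cross (q (i + 1) - q i) (z - q i) :=
  (map_sub (cross (q (i + 1) - q i)) z (q i)).symm

lemma side_vertex (q : ℕ → ℝ × ℝ) (i : ℕ) : side q i (q i) = 0 := by
  rw [side_apply, sub_self, map_zero]

lemma side_vertex_succ (q : ℕ → ℝ × ℝ) (i : ℕ) : side q i (q (i + 1)) = 0 := by
  rw [side_apply, cross_self]

lemma side_add_smul (q : ℕ → ℝ × ℝ) (i : ℕ) (z v : ℝ × ℝ) (t : ℝ) :
    side q i (z + t • v) = side q i z + t * cross (q (i + 1) - q i) v := by
  rw [side_apply, side_apply, add_sub_right_comm, map_add, map_smul, smul_eq_mul]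

lemma side_succ_vertex (q : ℕ → ℝ × ℝ) (i : ℕ) :
    side q (i + 1) (q i) = side q i (q (i + 2)) := by
  simp only [side_apply, cross_apply, Prod.fst_sub, Prod.snd_sub]; ring

lemma side_eq_zero_of_mem_seg (hz : z ∈ seg q i) : side q i z = 0 := by
  have := Set.mem_image_of_mem (side q i) hz
  rwa [seg, image_segment, side_vertex, side_vertex_succ, segment_same] at this

lemma pos_of_mem_segment {E : Type*} [AddCommGroup E] [Module ℝ E] {φ : E →ᵃ[ℝ] ℝ} {a b z : E}
    (ha : 0 < φ a) (hb : 0 < φ b) (hz : z ∈ segment ℝ a b) : 0 < φ z :=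
  ((convex_Ioi (0 : ℝ)).affine_preimage φ).segment_subset ha hb hz

lemma nonpos_of_mem_segment {E : Type*} [AddCommGroup E] [Module ℝ E] {φ : E →ᵃ[ℝ] ℝ} {a b z : E}
    (ha : φ a ≤ 0) (hb : φ b ≤ 0) (hz : z ∈ segment ℝ a b) : φ z ≤ 0 :=
  ((convex_Iic (0 : ℝ)).affine_preimage φ).segment_subset ha hb hz

lemma eq_left_of_mem_segment_of_nonpos {E : Type*} [AddCommGroup E] [Module ℝ E] {φ : E →ᵃ[ℝ] ℝ}
    {a b z : E} (ha : φ a = 0) (hb : 0 < φ b) (hz : z ∈ segment ℝ a b) (hφz : φ z ≤ 0) :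
    z = a := by
  rw [segment_eq_image_lineMap] at hz
  obtain ⟨s, ⟨hs, -⟩, rfl⟩ := hz
  rw [AffineMap.apply_lineMap, ha, AffineMap.lineMap_apply_module, smul_zero, zero_add,
    smul_eq_mul] at hφz
  rw [nonpos_of_mul_nonpos_left hφz hb |>.antisymm hs, AffineMap.lineMap_apply_zero]

/-- Displacements `w` of the vertices of a polygonal line that fix its two ends and move all other
vertices to the left of both segments they belong to. -/
structure IsLeftShift (n : ℕ) (q w : ℕ → ℝ × ℝ) : Prop where
  zero : w 0 = 0
  last : w n = 0
  left_next : ∀ m, 0 < m → m < n → 0 < cross (q (m + 1) - q m) (w m)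
  left_prev : ∀ m, m + 1 < n → 0 < cross (q (m + 1) - q m) (w (m + 1))

lemma IsSimplePolyline.exists_isLeftShift (hq : IsSimplePolyline n q) :
    ∃ w, IsLeftShift n q w := by
  have hcorner (m : ℕ) (hm : m + 1 < n) : ∃ w, 0 < cross (q (m + 1) - q m) w ∧
      0 < cross (q (m + 2) - q (m + 1)) w := by
    refine exists_cross_pos ?_
    rw [neg_sub, ← segment_inter_segment_subset_iff (hq.ne m (by omega)).symm (hq.ne (m + 1) hm)]
    exact fun z hz => (hq.meet m.lt_succ_self hm ((segment_symm ℝ _ _).subset hz.1) hz.2).2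
  choose! w hprev hnext using hcorner
  refine ⟨fun k => if k = 0 ∨ k = n then 0 else w (k - 1), by simp, by simp, ?_, ?_⟩
  · intro m hm hmn
    obtain ⟨m, rfl⟩ := Nat.exists_eq_add_one_of_ne_zero hm.ne'
    simpa [hmn.ne] using hnext m hmn
  · intro m hmn
    simpa [hmn.ne] using hprev m hmn

lemma tendsto_add_smul {X : Type*} [TopologicalSpace X] [AddCommGroup X] [Module ℝ X]
    [ContinuousAdd X] [ContinuousSMul ℝ X] (x v : X) :
    Tendsto (fun t : ℝ => x + t • v) (𝓝[>] 0) (𝓝 x) := by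
  have hcont : Continuous fun t : ℝ => x + t • v := by fun_prop
  simpa using (hcont.tendsto 0).mono_left nhdsWithin_le_nhds

lemma eventually_side_pos (v : ℝ × ℝ) (h : 0 < side q i z) :
    ∀ᶠ t : ℝ in 𝓝[>] 0, 0 < side q i (z + t • v) :=
  (((side q i).continuous_of_finiteDimensional.tendsto z).comp
    (tendsto_add_smul z v)).eventually_const_lt h

namespace IsLeftShift

lemma side_vertex_pos (hw : IsLeftShift n q w) (ht : 0 < t) (h0 : 0 < i) (hi : i < n) :
    0 < side q i ((q + t • w) i) := by
  rw [Pi.add_apply, Pi.smul_apply, side_add_smul, side_vertex, zero_add]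
  exact mul_pos ht (hw.left_next i h0 hi)

lemma side_vertex_succ_pos (hw : IsLeftShift n q w) (ht : 0 < t) (hi : i + 1 < n) :
    0 < side q i ((q + t • w) (i + 1)) := by
  rw [Pi.add_apply, Pi.smul_apply, side_add_smul, side_vertex_succ, zero_add]
  exact mul_pos ht (hw.left_prev i hi)

lemma add_smul_zero (hw : IsLeftShift n q w) (t : ℝ) : (q + t • w) 0 = q 0 := by
  rw [Pi.add_apply, Pi.smul_apply, hw.zero, smul_zero, add_zero]

lemma add_smul_last (hw : IsLeftShift n q w) (t : ℝ) : (q + t • w) n = q n := by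
  rw [Pi.add_apply, Pi.smul_apply, hw.last, smul_zero, add_zero]

lemma mem_ends_of_side_nonpos (hw : IsLeftShift n q w) (hn : 2 ≤ n) (ht : 0 < t) (hi : i < n)
    (hz : z ∈ seg (q + t • w) i) (hside : side q i z ≤ 0) : z ∈ ({q 0, q n} : Set (ℝ × ℝ)) := by
  obtain rfl | h0 := i.eq_zero_or_pos
  · left
    rw [seg, hw.add_smul_zero] at hz
    exact eq_left_of_mem_segment_of_nonpos (side_vertex q 0)
      (hw.side_vertex_succ_pos ht (by omega)) hz hside
  obtain rfl | hin := (Nat.succ_le_iff.2 hi).eq_or_lt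
  · right
    rw [seg, hw.add_smul_last, segment_symm] at hz
    exact eq_left_of_mem_segment_of_nonpos (side_vertex_succ q i)
      (hw.side_vertex_pos ht h0 hi) hz hside
  · exact absurd hside
      (pos_of_mem_segment (hw.side_vertex_pos ht h0 hi) (hw.side_vertex_succ_pos ht hin) hz).not_ge

/- At a left turn the shifted segment lies strictly to the left of the next one; otherwise the next
one does not reach the left side of the unshifted segment. The same dichotomy, mirrored, serves
the segment before. -/
lemma eventually_inter_seg_succ_subset (hw : IsLeftShift n q w) (hn : 2 ≤ n) (hi : i + 1 < n) :
    ∀ᶠ t : ℝ in 𝓝[>] 0, seg (q + t • w) i ∩ seg q (i + 1) ⊆ {q 0, q n} := by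
  rcases lt_or_ge 0 (side q i (q (i + 2))) with hleft | hright
  · rw [← side_succ_vertex] at hleft
    filter_upwards [eventually_side_pos (w i) hleft, self_mem_nhdsWithin] with t hti ht z ⟨hz, hz'⟩
    exact absurd (side_eq_zero_of_mem_seg hz')
      (pos_of_mem_segment hti (hw.side_vertex_pos ht i.succ_pos hi) hz).ne'
  · filter_upwards [self_mem_nhdsWithin] with t ht z ⟨hz, hz'⟩
    exact hw.mem_ends_of_side_nonpos hn ht (by omega) hz
      (nonpos_of_mem_segment (side_vertex_succ q i).le hright hz')

lemma eventually_succ_inter_seg_subset (hw : IsLeftShift n q w) (hn : 2 ≤ n) (hi : i + 1 < n) :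
    ∀ᶠ t : ℝ in 𝓝[>] 0, seg (q + t • w) (i + 1) ∩ seg q i ⊆ {q 0, q n} := by
  rcases lt_or_ge 0 (side q i (q (i + 2))) with hleft | hright
  · filter_upwards [eventually_side_pos (w (i + 2)) hleft, self_mem_nhdsWithin]
      with t hti ht z ⟨hz, hz'⟩
    exact absurd (side_eq_zero_of_mem_seg hz')
      (pos_of_mem_segment (hw.side_vertex_succ_pos ht hi) hti hz).ne'
  · rw [← side_succ_vertex] at hright
    filter_upwards [self_mem_nhdsWithin] with t ht z ⟨hz, hz'⟩
    exact hw.mem_ends_of_side_nonpos hn ht hi hz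
      (nonpos_of_mem_segment hright (side_vertex q (i + 1)).le hz')

lemma eventually_inter_seg_subset (hw : IsLeftShift n q w) (hq : IsSimplePolyline n q)
    (hn : 2 ≤ n) {j : ℕ} (hi : i < n) (hj : j < n) :
    ∀ᶠ t : ℝ in 𝓝[>] 0, seg (q + t • w) i ∩ seg q j ⊆ {q 0, q n} := by
  rcases eq_or_ne j i with rfl | hij
  · filter_upwards [self_mem_nhdsWithin] with t ht z ⟨hz, hz'⟩
    exact hw.mem_ends_of_side_nonpos hn ht hi hz (side_eq_zero_of_mem_seg hz').le
  rcases eq_or_ne j (i + 1) with rfl | hij'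
  · exact hw.eventually_inter_seg_succ_subset hn hj
  rcases eq_or_ne i (j + 1) with rfl | hji
  · exact hw.eventually_succ_inter_seg_subset hn hi
  have hdisj : Disjoint (seg q i) (seg q j) := Set.disjoint_left.2 fun z hzi hzj => by
    rcases hij.lt_or_gt with h | h
    · exact hji (hq.meet h hi hzj hzi).1
    · exact hij' (hq.meet h hj hzi hzj).1
  filter_upwards [eventually_disjoint_seg (tendsto_add_smul q w) tendsto_const_nhds hdisj] with t ht
  simp only [ht.inter_eq, Set.empty_subset]

lemma eventually_inter_polyline_subset (hw : IsLeftShift n q w) (hq : IsSimplePolyline n q)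
    (hn : 2 ≤ n) :
    ∀ᶠ t : ℝ in 𝓝[>] 0, polyline (q + t • w) 0 n ∩ polyline q 0 n ⊆ {q 0, q n} := by
  have hseg : ∀ᶠ t : ℝ in 𝓝[>] 0, ∀ i < n, ∀ j < n,
      seg (q + t • w) i ∩ seg q j ⊆ {q 0, q n} :=
    eventually_forall_lt fun i hi => eventually_forall_lt fun j hj =>
      hw.eventually_inter_seg_subset hq hn hi hj
  filter_upwards [hseg] with t ht z ⟨hz, hz'⟩
  obtain ⟨i, -, hi, hzi⟩ := mem_polyline.1 hz
  obtain ⟨j, -, hj, hzj⟩ := mem_polyline.1 hz'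
  exact ht i hi j hj ⟨hzi, hzj⟩

end IsLeftShift

end LeftShift

section MultiDrawing

variable {V I : Type*} {ends : I → V × V}

/-- The two ends of the edge `i` of a multigraph, whose edges are indexed by `I` and oriented. -/
def endSet (ends : I → V × V) (i : I) : Set V := {(ends i).1, (ends i).2}

/-- A drawing in the plane without crossings of the multigraph on `V` in which the edge `i : I` runs
from `(ends i).1` to `(ends i).2`; it is drawn as the polygonal line with vertices
`line i 0, …, line i (size i)`. -/
structure MultiDrawing (ends : I → V × V) where
  /-- the point that represents a vertex -/
  pt : V → ℝ × ℝ
  /-- the number of segments of the polygonal line that represents an edge -/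
  size : I → ℕ
  /-- the vertices of the polygonal line that represents an edge -/
  line : I → ℕ → ℝ × ℝ
  pt_injective : Function.Injective pt
  line_zero : ∀ i, line i 0 = pt (ends i).1
  line_size : ∀ i, line i (size i) = pt (ends i).2
  isSimplePolyline : ∀ i, IsSimplePolyline (size i) (line i)
  mem_endSet : ∀ i v, pt v ∈ polyline (line i) 0 (size i) → v ∈ endSet ends i
  inter_subset : ∀ i i', i ≠ i' → polyline (line i) 0 (size i) ∩ polyline (line i') 0 (size i') ⊆
    pt '' (endSet ends i ∩ endSet ends i')

lemma PlaneDrawing.exists_multiDrawing {G : SimpleGraph V} (D : PlaneDrawing G) (M : ℕ) :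
    ∃ D' : MultiDrawing fun e : G.edgeSet => e.1.out, ∀ e, M ≤ D'.size e := by
  have hout (e : Sym2 V) : s(e.out.1, e.out.2) = e := e.out_eq
  have hmem (e : G.edgeSet) (v : V) : v ∈ e.1 ↔ v ∈ endSet (fun e : G.edgeSet => e.1.out) e := by
    conv_lhs => rw [← hout e.1]
    exact Sym2.mem_iff
  have harc (e : G.edgeSet) : ∃ (m : ℕ) (r : ℕ → ℝ × ℝ), IsSimplePolyline m r ∧ M ≤ m ∧
      r 0 = D.pt e.1.out.1 ∧ r m = D.pt e.1.out.2 ∧ polyline r 0 m = D.arc e.1 := by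
    have hadj : G.Adj e.1.out.1 e.1.out.2 := by
      rw [← SimpleGraph.mem_edgeSet, hout]
      exact e.2
    obtain ⟨n, q, hq, hn, h0, hqn, hA⟩ :=
      (D.isPolygonalArc _ _ hadj).exists_isSimplePolyline
    obtain ⟨m, r, hr, -, hM, hr0, hrm, hrq⟩ := hq.exists_le_card hn M
    exact ⟨m, r, hr, hM, hr0.trans h0, hrm.trans hqn, by rw [hrq, hA, hout]⟩
  choose size line hsimple hsize hzero hlast hline using harc
  exact ⟨{
    pt := D.pt
    size := size
    line := line
    pt_injective := D.pt_injective
    line_zero := hzero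
    line_size := hlast
    isSimplePolyline := hsimple
    mem_endSet := fun e v hv => (hmem e v).1 (D.mem_of_pt_mem _ e.2 v (hline e ▸ hv))
    inter_subset := fun e e' hne z hz => by
      rw [hline, hline] at hz
      obtain ⟨v, hv, hv', rfl⟩ := D.inter_subset _ e.2 _ e'.2 (Subtype.coe_ne_coe.2 hne) z hz
      exact ⟨v, ⟨(hmem e v).1 hv, (hmem e' v).1 hv'⟩, rfl⟩ }, hsize⟩

namespace MultiDrawing

variable (D : MultiDrawing ends)

lemma image_endSet (i : I) : D.pt '' endSet ends i = {D.line i 0, D.line i (D.size i)} := by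
  rw [endSet, Set.image_pair, D.line_zero, D.line_size]

/-- The line of the edge `i` and, for the index `(i, true)`, its displacement by `t • w i`. -/
def doubledLine (w : I → ℕ → ℝ × ℝ) (t : ℝ) (i : I × Bool) : ℕ → ℝ × ℝ :=
  cond i.2 (D.line i.1 + t • w i.1) (D.line i.1)

variable {w : I → ℕ → ℝ × ℝ}

lemma tendsto_doubledLine (w : I → ℕ → ℝ × ℝ) (i : I × Bool) :
    Tendsto (fun t => D.doubledLine w t i) (𝓝[>] 0) (𝓝 (D.line i.1)) := by
  obtain ⟨i, _ | _⟩ := i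
  exacts [tendsto_const_nhds, tendsto_add_smul _ _]

lemma doubledLine_zero (hw : ∀ i, IsLeftShift (D.size i) (D.line i) (w i)) (t : ℝ)
    (i : I × Bool) : D.doubledLine w t i 0 = D.line i.1 0 := by
  obtain ⟨i, _ | _⟩ := i
  exacts [rfl, (hw i).add_smul_zero t]

lemma doubledLine_size (hw : ∀ i, IsLeftShift (D.size i) (D.line i) (w i)) (t : ℝ)
    (i : I × Bool) : D.doubledLine w t i (D.size i.1) = D.line i.1 (D.size i.1) := by
  obtain ⟨i, _ | _⟩ := i
  exacts [rfl, (hw i).add_smul_last t]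

lemma eventually_isSimplePolyline_doubledLine (w : I → ℕ → ℝ × ℝ) (i : I × Bool) :
    ∀ᶠ t in 𝓝[>] 0, IsSimplePolyline (D.size i.1) (D.doubledLine w t i) :=
  (D.isSimplePolyline i.1).eventually (D.tendsto_doubledLine w i)

lemma eventually_mem_endSet_of_mem_doubledLine (w : I → ℕ → ℝ × ℝ) (i : I × Bool) (v : V) :
    ∀ᶠ t in 𝓝[>] 0, D.pt v ∈ polyline (D.doubledLine w t i) 0 (D.size i.1) →
      v ∈ endSet ends i.1 := by
  by_cases hv : v ∈ endSet ends i.1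
  · exact Eventually.of_forall fun t _ => hv
  · filter_upwards [eventually_notMem_polyline (D.tendsto_doubledLine w i)
      fun h => hv (D.mem_endSet i.1 v h)] with t ht h
    exact absurd h ht

lemma eventually_doubledLine_inter_subset (hw : ∀ i, IsLeftShift (D.size i) (D.line i) (w i))
    {i i' : I × Bool} (hsize : 2 ≤ D.size i.1) (h : i ≠ i') :
    ∀ᶠ t in 𝓝[>] 0, polyline (D.doubledLine w t i) 0 (D.size i.1) ∩
      polyline (D.doubledLine w t i') 0 (D.size i'.1) ⊆
        D.pt '' (endSet ends i.1 ∩ endSet ends i'.1) := by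
  by_cases hi : i.1 = i'.1
  · have hshift := (hw i.1).eventually_inter_polyline_subset (D.isSimplePolyline i.1) hsize
    rw [← D.image_endSet] at hshift
    obtain ⟨i, b⟩ := i
    obtain ⟨i', b'⟩ := i'
    obtain rfl : i = i' := hi
    rw [Set.inter_self]
    cases b <;> cases b'
    · exact absurd rfl h
    · exact hshift.mono fun t ht => (Set.inter_comm _ _).trans_subset ht
    · exact hshift
    · exact absurd rfl h
  · exact (D.isSimplePolyline i.1).eventually_inter_subset (D.isSimplePolyline i'.1) hsize
      (D.tendsto_doubledLine w i) (D.tendsto_doubledLine w i') (D.doubledLine_zero hw · i)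
      (D.doubledLine_size hw · i) (D.doubledLine_zero hw · i') (D.doubledLine_size hw · i')
      (D.image_endSet i.1 ▸ Set.image_mono Set.inter_subset_left)
      (D.image_endSet i'.1 ▸ Set.image_mono Set.inter_subset_right)
      (D.inter_subset i.1 i'.1 hi)

lemma exists_doubled [Finite V] [Finite I] (hsize : ∀ i, 2 ≤ D.size i) :
    ∃ D' : MultiDrawing fun i : I × Bool => ends i.1, ∀ i, D'.size i = D.size i.1 := by
  choose w hw using fun i => (D.isSimplePolyline i).exists_isLeftShift
  have hsimple := eventually_all.2 (D.eventually_isSimplePolyline_doubledLine w)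
  have hends := eventually_all.2 fun i =>
    eventually_all.2 (D.eventually_mem_endSet_of_mem_doubledLine w i)
  have hinter : ∀ᶠ t in 𝓝[>] 0, ∀ i i' : I × Bool, i ≠ i' →
      polyline (D.doubledLine w t i) 0 (D.size i.1) ∩
        polyline (D.doubledLine w t i') 0 (D.size i'.1) ⊆
          D.pt '' (endSet ends i.1 ∩ endSet ends i'.1) :=
    eventually_all.2 fun i => eventually_all.2 fun i' => eventually_imp_distrib_left.2 fun h =>
      D.eventually_doubledLine_inter_subset hw (hsize i.1) h
  obtain ⟨t, hsimple, hends, hinter⟩ := (hsimple.and (hends.and hinter)).exists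
  exact ⟨{
    pt := D.pt
    size := fun i => D.size i.1
    line := D.doubledLine w t
    pt_injective := D.pt_injective
    line_zero := fun i => (D.doubledLine_zero hw t i).trans (D.line_zero i.1)
    line_size := fun i => (D.doubledLine_size hw t i).trans (D.line_size i.1)
    isSimplePolyline := hsimple
    mem_endSet := hends
    inter_subset := hinter }, fun _ => rfl⟩

end MultiDrawing

end MultiDrawing

section Subdivision

variable {V I : Type*} {ends : I → V × V} {ℓ : I → ℕ} {i i' : I} {j j' : ℕ}

/-- The vertices of the subdivision of a multigraph on `V` in which the edge `i` becomes a path of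
length `ℓ i`. -/
abbrev SubdivVert (V : Type*) {I : Type*} (ℓ : I → ℕ) : Type _ :=
  V ⊕ Σ i, Set.Ioo 0 (ℓ i)

variable (ends ℓ) in
/-- The `j`-th vertex of the path that replaces the edge `i` in a subdivision; it is meaningful for
`j ≤ ℓ i`. -/
def node (i : I) (j : ℕ) : SubdivVert V ℓ :=
  if h : j ∈ Set.Ioo 0 (ℓ i) then Sum.inr ⟨i, j, h⟩
  else if j = 0 then Sum.inl (ends i).1 else Sum.inl (ends i).2

variable (ends ℓ) in
/-- The `j`-th edge of the path that replaces the edge `i` in a subdivision. -/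
def nodeEdge (i : I) (j : ℕ) : Sym2 (SubdivVert V ℓ) := s(node ends ℓ i j, node ends ℓ i (j + 1))

variable (ends ℓ) in
/-- The graph obtained from a loopless multigraph by replacing each edge `i` by a path of
length `ℓ i`. -/
def subdivision : SimpleGraph (SubdivVert V ℓ) :=
  SimpleGraph.fromEdgeSet {e | ∃ i j, j < ℓ i ∧ nodeEdge ends ℓ i j = e}

lemma node_zero (i : I) : node ends ℓ i 0 = Sum.inl (ends i).1 := by
  rw [node, dif_neg (by simp), if_pos rfl]

lemma node_length (h : 0 < ℓ i) : node ends ℓ i (ℓ i) = Sum.inl (ends i).2 := by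
  rw [node, dif_neg (by simp), if_neg h.ne']

lemma node_of_mem_Ioo (h : j ∈ Set.Ioo 0 (ℓ i)) : node ends ℓ i j = Sum.inr ⟨i, j, h⟩ := dif_pos h

lemma eq_of_node_eq_node (h : j ∈ Set.Ioo 0 (ℓ i)) (he : node ends ℓ i' j' = node ends ℓ i j) :
    i' = i ∧ j' = j := by
  rw [node_of_mem_Ioo h, node] at he
  split_ifs at he
  obtain ⟨rfl, he⟩ := Sigma.mk.inj_iff.1 (Sum.inr_injective he)
  exact ⟨rfl, congrArg Subtype.val (eq_of_heq he)⟩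

lemma node_injOn (hi : (ends i).1 ≠ (ends i).2) :
    Set.InjOn (node ends ℓ i) (Set.Iic (ℓ i)) := by
  intro j hj j' hj' he
  rw [Set.mem_Iic] at hj hj'
  by_cases h : j ∈ Set.Ioo 0 (ℓ i)
  · exact (eq_of_node_eq_node h he.symm).2.symm
  by_cases h' : j' ∈ Set.Ioo 0 (ℓ i)
  · exact (eq_of_node_eq_node h' he).2
  simp only [node, dif_neg h, dif_neg h'] at he
  simp only [Set.mem_Ioo] at h h'
  split_ifs at he with h0 h0' h0'
  · omega
  · exact absurd (Sum.inl_injective he) hi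
  · exact absurd (Sum.inl_injective he).symm hi
  · omega

lemma nodeEdge_inj (hℓ : 2 ≤ ℓ i) (hi : (ends i).1 ≠ (ends i).2) (hj : j < ℓ i) (hj' : j' < ℓ i')
    (he : nodeEdge ends ℓ i' j' = nodeEdge ends ℓ i j) : i' = i ∧ j' = j := by
  obtain rfl : i' = i := by
    rw [nodeEdge, nodeEdge, Sym2.eq_iff] at he
    obtain rfl | hj0 := j.eq_zero_or_pos
    · have h1 : 0 + 1 ∈ Set.Ioo 0 (ℓ i) := ⟨one_pos, hℓ⟩
      rcases he with ⟨-, he⟩ | ⟨he, -⟩ <;> exact (eq_of_node_eq_node h1 he).1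
    · rcases he with ⟨he, -⟩ | ⟨-, he⟩ <;> exact (eq_of_node_eq_node ⟨hj0, hj⟩ he).1
  refine ⟨rfl, ?_⟩
  have hinj {k k' : ℕ} (hk : k ≤ ℓ i') (hk' : k' ≤ ℓ i')
    (h : node ends ℓ i' k = node ends ℓ i' k') : k = k' := node_injOn hi hk hk' h
  rw [nodeEdge, nodeEdge, Sym2.eq_iff] at he
  rcases he with ⟨he, -⟩ | ⟨he, he'⟩
  · exact hinj hj'.le hj.le he
  · have := hinj hj'.le hj he
    have := hinj hj' hj.le he'
    omega

lemma mem_edgeSet_subdivision (hends : ∀ i, (ends i).1 ≠ (ends i).2)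
    {e : Sym2 (SubdivVert V ℓ)} :
    e ∈ (subdivision ends ℓ).edgeSet ↔ ∃ i j, j < ℓ i ∧ nodeEdge ends ℓ i j = e := by
  rw [subdivision, SimpleGraph.edgeSet_fromEdgeSet, Set.mem_sdiff, Set.mem_ofPred_eq,
    and_iff_left_iff_imp]
  rintro ⟨i, j, hj, rfl⟩ hdiag
  have hloop : node ends ℓ i j = node ends ℓ i (j + 1) := hdiag
  have : j = j + 1 := node_injOn (hends i) hj.le hj hloop
  omega

lemma node_adj_node_succ (hends : ∀ i, (ends i).1 ≠ (ends i).2) (hj : j < ℓ i) :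
    (subdivision ends ℓ).Adj (node ends ℓ i j) (node ends ℓ i (j + 1)) :=
  (mem_edgeSet_subdivision hends).2 ⟨i, j, hj, rfl⟩

end Subdivision

namespace MultiDrawing

variable {V I : Type*} {ends : I → V × V} (D : MultiDrawing ends) {ℓ : I → ℕ} {i i' : I} {j j' : ℕ}

/-- The index of the point of the line of the edge `i` that represents the `j`-th vertex of the path
by which `i` is subdivided: the last part of the subdivided line takes up all remaining
segments. -/
def pos (ℓ : I → ℕ) (i : I) (j : ℕ) : ℕ := if j < ℓ i then j else D.size i

/-- The point that represents a vertex of the subdivision. -/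
def subdivPt (ℓ : I → ℕ) : SubdivVert V ℓ → ℝ × ℝ := Sum.elim D.pt fun x => D.line x.1 x.2

/-- The part of the line of the edge `i` that represents the `j`-th edge of the path by which `i` is
subdivided. -/
def subArc (ℓ : I → ℕ) (i : I) (j : ℕ) : Set (ℝ × ℝ) :=
  polyline (D.line i) (D.pos ℓ i j) (D.pos ℓ i (j + 1))

lemma pos_of_lt (hj : j < ℓ i) : D.pos ℓ i j = j := if_pos hj

lemma pos_length (ℓ : I → ℕ) (i : I) : D.pos ℓ i (ℓ i) = D.size i := if_neg (lt_irrefl _)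

lemma strictMonoOn_pos (hsize : ℓ i ≤ D.size i) : StrictMonoOn (D.pos ℓ i) (Set.Iic (ℓ i)) := by
  intro j _ j' hj' hlt
  rw [Set.mem_Iic] at hj'
  simp only [pos]
  split_ifs <;> omega

lemma pos_le_size (hsize : ℓ i ≤ D.size i) (j : ℕ) : D.pos ℓ i j ≤ D.size i := by
  simp only [pos]
  split_ifs <;> omega

lemma subArc_subset (hsize : ℓ i ≤ D.size i) (j : ℕ) :
    D.subArc ℓ i j ⊆ polyline (D.line i) 0 (D.size i) :=
  polyline_mono (Nat.zero_le _) (D.pos_le_size hsize _)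

lemma subdivPt_node (hℓ : 0 < ℓ i) (hj : j ≤ ℓ i) :
    D.subdivPt ℓ (node ends ℓ i j) = D.line i (D.pos ℓ i j) := by
  obtain rfl | hj0 := j.eq_zero_or_pos
  · rw [node_zero, D.pos_of_lt hℓ, D.line_zero]; rfl
  obtain rfl | hjℓ := hj.eq_or_lt
  · rw [node_length hℓ, D.pos_length, D.line_size]; rfl
  · rw [node_of_mem_Ioo ⟨hj0, hjℓ⟩, D.pos_of_lt hjℓ]; rfl

lemma line_notMem_image_endSet (hj0 : 0 < j) (hj : j < D.size i) :
    D.line i j ∉ D.pt '' endSet ends i := by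
  rw [D.image_endSet]
  rintro (h | h)
  · exact hj0.ne' ((D.isSimplePolyline i).vertex_inj hj.le (Nat.zero_le _) h)
  · exact hj.ne ((D.isSimplePolyline i).vertex_inj hj.le le_rfl h)

lemma exists_node_eq (hℓ : 0 < ℓ i) (hsize : ∀ i, ℓ i ≤ D.size i) {x : SubdivVert V ℓ}
    (hx : D.subdivPt ℓ x ∈ polyline (D.line i) 0 (D.size i)) : ∃ j ≤ ℓ i, node ends ℓ i j = x := by
  obtain v | ⟨i', j', hj'⟩ := x
  · obtain rfl | rfl := D.mem_endSet i v hx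
    exacts [⟨0, hℓ.le, node_zero i⟩, ⟨ℓ i, le_rfl, node_length hℓ⟩]
  · obtain rfl | hne := eq_or_ne i' i
    · exact ⟨j', hj'.2.le, node_of_mem_Ioo hj'⟩
    · have hlt : j' < D.size i' := hj'.2.trans_le (hsize i')
      have hmem : D.line i' j' ∈ polyline (D.line i') 0 (D.size i') :=
        seg_subset_polyline j'.zero_le hlt (left_mem_seg _ _)
      exact absurd (Set.image_mono Set.inter_subset_left (D.inter_subset i' i hne ⟨hmem, hx⟩))
        (D.line_notMem_image_endSet hj'.1 hlt)

lemma subdivPt_injective (hsize : ∀ i, ℓ i ≤ D.size i) : Function.Injective (D.subdivPt ℓ) := by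
  have hinr (x : SubdivVert V ℓ) (y : Σ i, Set.Ioo 0 (ℓ i))
      (h : D.subdivPt ℓ x = D.subdivPt ℓ (Sum.inr y)) : x = Sum.inr y := by
    obtain ⟨i, j, hj⟩ := y
    have hℓ : 0 < ℓ i := hj.1.trans hj.2
    have hx : D.subdivPt ℓ x ∈ polyline (D.line i) 0 (D.size i) := h ▸
      seg_subset_polyline j.zero_le (hj.2.trans_le (hsize i)) (left_mem_seg _ _)
    obtain ⟨j', hj', rfl⟩ := D.exists_node_eq hℓ hsize hx
    rw [← node_of_mem_Ioo (ends := ends) hj, D.subdivPt_node hℓ hj',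
      D.subdivPt_node hℓ hj.2.le] at h
    have hpos := (D.isSimplePolyline i).vertex_inj (D.pos_le_size (hsize i) _)
      (D.pos_le_size (hsize i) _) h
    rw [(D.strictMonoOn_pos (hsize i)).injOn hj' hj.2.le hpos, node_of_mem_Ioo hj]
  rintro (u | x) (v | y) h
  · exact congrArg Sum.inl (D.pt_injective h)
  · exact hinr _ _ h
  · exact (hinr _ _ h.symm).symm
  · exact hinr _ _ h

lemma mem_nodeEdge_of_mem_subArc (hsize : ∀ i, ℓ i ≤ D.size i) (hj : j < ℓ i)
    {x : SubdivVert V ℓ} (hx : D.subdivPt ℓ x ∈ D.subArc ℓ i j) : x ∈ nodeEdge ends ℓ i j := by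
  have hℓ : 0 < ℓ i := j.zero_le.trans_lt hj
  obtain ⟨k, hk, rfl⟩ := D.exists_node_eq hℓ hsize (D.subArc_subset (hsize i) j hx)
  rw [D.subdivPt_node hℓ hk] at hx
  obtain ⟨hjk, hkj⟩ := (D.isSimplePolyline i).vertex_mem_polyline (D.pos_le_size (hsize i) k)
    (D.pos_le_size (hsize i) (j + 1)) hx
  rw [(D.strictMonoOn_pos (hsize i)).le_iff_le hj.le hk] at hjk
  rw [(D.strictMonoOn_pos (hsize i)).le_iff_le hk hj] at hkj
  obtain rfl | rfl : k = j ∨ k = j + 1 := by omega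
  exacts [Sym2.mem_mk_left _ _, Sym2.mem_mk_right _ _]

lemma isPolygonalArc_subArc (hsize : ℓ i ≤ D.size i) (hj : j < ℓ i) :
    IsPolygonalArc (D.subArc ℓ i j) (D.subdivPt ℓ (node ends ℓ i j))
      (D.subdivPt ℓ (node ends ℓ i (j + 1))) := by
  have hℓ : 0 < ℓ i := j.zero_le.trans_lt hj
  rw [D.subdivPt_node hℓ hj.le, D.subdivPt_node hℓ hj]
  exact (D.isSimplePolyline i).isPolygonalArc
    (D.strictMonoOn_pos hsize hj.le hj j.lt_succ_self) (D.pos_le_size hsize _)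

lemma eq_subdivPt_node_of_mem_subArc (hsize : ℓ i ≤ D.size i) (hj : j < j') (hj' : j' < ℓ i)
    {z : ℝ × ℝ} (hz : z ∈ D.subArc ℓ i j) (hz' : z ∈ D.subArc ℓ i j') :
    D.subdivPt ℓ (node ends ℓ i (j + 1)) = z := by
  have hle : D.pos ℓ i (j + 1) ≤ D.pos ℓ i j' :=
    (D.strictMonoOn_pos hsize).monotoneOn (hj.trans hj') hj'.le hj
  rw [((D.isSimplePolyline i).polyline_inter hle (D.pos_le_size hsize _) hz hz').2,
    D.subdivPt_node (by omega) (by omega)]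

lemma exists_subdivPt_eq_of_mem_subArc (hsize : ∀ i, ℓ i ≤ D.size i) (hj : j < ℓ i)
    (hj' : j' < ℓ i') (hne : nodeEdge ends ℓ i j ≠ nodeEdge ends ℓ i' j') {z : ℝ × ℝ}
    (hz : z ∈ D.subArc ℓ i j) (hz' : z ∈ D.subArc ℓ i' j') : ∃ x, D.subdivPt ℓ x = z := by
  obtain rfl | hi := eq_or_ne i i'
  · obtain hlt | rfl | hlt := lt_trichotomy j j'
    · exact ⟨_, D.eq_subdivPt_node_of_mem_subArc (hsize i) hlt hj' hz hz'⟩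
    · exact absurd rfl hne
    · exact ⟨_, D.eq_subdivPt_node_of_mem_subArc (hsize i) hlt hj hz' hz⟩
  · obtain ⟨v, -, hv⟩ := D.inter_subset i i' hi
      ⟨D.subArc_subset (hsize i) j hz, D.subArc_subset (hsize i') j' hz'⟩
    exact ⟨Sum.inl v, hv⟩

include D in
lemma isPlanar_subdivision (hℓ : ∀ i, 2 ≤ ℓ i) (hsize : ∀ i, ℓ i ≤ D.size i)
    (hends : ∀ i, (ends i).1 ≠ (ends i).2) : IsPlanar (subdivision ends ℓ) := by
  let arc (e : Sym2 (SubdivVert V ℓ)) : Set (ℝ × ℝ) :=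
    {z | ∃ i j, j < ℓ i ∧ nodeEdge ends ℓ i j = e ∧ z ∈ D.subArc ℓ i j}
  have harc {i : I} {j : ℕ} (hj : j < ℓ i) : arc (nodeEdge ends ℓ i j) = D.subArc ℓ i j := by
    refine subset_antisymm ?_ fun z hz => ⟨i, j, hj, rfl, hz⟩
    rintro z ⟨i', j', hj', he, hz⟩
    obtain ⟨rfl, rfl⟩ := nodeEdge_inj (hℓ i) (hends i) hj hj' he
    exact hz
  refine ⟨⟨D.subdivPt ℓ, arc, D.subdivPt_injective hsize, fun x y hxy => ?_, fun e he x hx => ?_,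
    fun e he e' he' hne z ⟨hz, hz'⟩ => ?_⟩⟩
  · obtain ⟨i, j, hj, he⟩ := (mem_edgeSet_subdivision hends).1 ((SimpleGraph.mem_edgeSet _).2 hxy)
    rw [← he, harc hj]
    obtain ⟨rfl, rfl⟩ | ⟨rfl, rfl⟩ := Sym2.eq_iff.1 he
    · exact D.isPolygonalArc_subArc (hsize i) hj
    · exact (D.isPolygonalArc_subArc (hsize i) hj).symm
  · obtain ⟨i, j, hj, rfl⟩ := (mem_edgeSet_subdivision hends).1 he
    exact D.mem_nodeEdge_of_mem_subArc hsize hj (harc hj ▸ hx)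
  · obtain ⟨i, j, hj, rfl⟩ := (mem_edgeSet_subdivision hends).1 he
    obtain ⟨i', j', hj', rfl⟩ := (mem_edgeSet_subdivision hends).1 he'
    rw [harc hj] at hz
    rw [harc hj'] at hz'
    obtain ⟨x, rfl⟩ := D.exists_subdivPt_eq_of_mem_subArc hsize hj hj' hne hz hz'
    exact ⟨x, D.mem_nodeEdge_of_mem_subArc hsize hj hz,
      D.mem_nodeEdge_of_mem_subArc hsize hj' hz', rfl⟩

end MultiDrawing

section Cycles

open SimpleGraph

variable {W : Type*} {H : SimpleGraph W} {u v : W}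

lemma exists_mem_edges_ne {c : H.Walk v v} (hc : c.IsCycle) {e : Sym2 W} (he : e ∈ c.edges) {x : W}
    (hx : x ∈ e) : ∃ e' ∈ c.edges, e' ≠ e ∧ x ∈ e' := by
  obtain ⟨y, rfl⟩ := hx
  have htwo := hc.ncard_neighborSet_toSubgraph_eq_two (c.fst_mem_support_of_mem_edges he)
  obtain ⟨z, hz, hzy⟩ := Set.exists_ne_of_one_lt_ncard (htwo ▸ one_lt_two) y
  exact ⟨s(x, z), Walk.adj_toSubgraph_iff_mem_edges.1 hz, fun h => hzy (Sym2.congr_right.1 h),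
    Sym2.mem_mk_left x z⟩

lemma length_eq_of_edges_subset {c : H.Walk v v} {d : H.Walk u u} (hc : c.IsCycle)
    (hd : d.IsCycle) (h : d.edges ⊆ c.edges) : d.length = c.length := by
  classical
  have hneighbor (x : W) (hx : x ∈ d.support) :
      d.toSubgraph.neighborSet x = c.toSubgraph.neighborSet x := by
    have htwo := hd.ncard_neighborSet_toSubgraph_eq_two hx
    have hle : d.toSubgraph.neighborSet x ⊆ c.toSubgraph.neighborSet x := fun y hy =>
      Walk.adj_toSubgraph_iff_mem_edges.2 (h (Walk.adj_toSubgraph_iff_mem_edges.1 hy))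
    obtain ⟨y, hy⟩ := Set.nonempty_of_ncard_ne_zero (htwo ▸ two_ne_zero)
    refine Set.eq_of_subset_of_ncard_le hle ?_ (Set.finite_of_ncard_ne_zero ?_) <;>
      rw [hc.ncard_neighborSet_toSubgraph_eq_two (c.mem_verts_toSubgraph.1 (hle hy).fst_mem)]
    · exact htwo.ge
    · exact two_ne_zero
  have hclosed (x y : W) (hxy : s(x, y) ∈ c.edges) (hx : x ∈ d.support) : s(x, y) ∈ d.edges :=
    Walk.adj_toSubgraph_iff_mem_edges.1
      ((hneighbor x hx).symm.subset (Walk.adj_toSubgraph_iff_mem_edges.2 hxy))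
  have hu : u ∈ c.support := by
    have he := h (d.mk_start_snd_mem_edges hd.not_nil)
    exact c.fst_mem_support_of_mem_edges he
  have hsupport (y : W) (hy : y ∈ c.support) : y ∈ d.support := by
    by_contra hyd
    have hy' : y ∈ (c.rotate u hu).support := (c.mem_support_rotate_iff u hu).2 hy
    obtain ⟨b, hb, hbd, hbn⟩ := ((c.rotate u hu).takeUntil y hy').exists_boundary_dart
      {x | x ∈ d.support} d.start_mem_support hyd
    have hbc : b.edge ∈ c.edges := (c.rotate_edges u hu).mem_iff.1
      (List.mem_map_of_mem (Walk.darts_takeUntil_subset_darts _ _ hb))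
    exact hbn (d.snd_mem_support_of_mem_edges (hclosed _ _ hbc hbd))
  have hcd : c.edges ⊆ d.edges := fun e he => by
    induction e with
    | _ x y => exact hclosed x y he (hsupport x (c.fst_mem_support_of_mem_edges he))
  rw [← d.length_edges, ← c.length_edges]
  exact ((List.perm_ext_iff_of_nodup hd.edges_nodup hc.edges_nodup).2
    fun e => ⟨@h e, @hcd e⟩).length_eq

lemma not_isAcyclic_of_forall_exists_ne [Finite W] (huv : H.Adj u v)
    (h : ∀ x y, H.Adj x y → ∃ z ≠ y, H.Adj x z) : ¬ H.IsAcyclic := by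
  intro hH
  have : Nonempty W := ⟨u⟩
  obtain ⟨x, y, p, hp, hmax⟩ := Walk.exists_isPath_forall_isPath_length_le_length H
  have hnil : ¬ p.Nil := fun hnil => by
    have := hmax u v huv.toWalk (by simp [huv.ne])
    rw [Walk.length_eq_zero_iff.2 hnil] at this
    simp at this
  obtain ⟨z, hz, hyz⟩ := h y _ (p.adj_penultimate hnil).symm
  have hpath : (p.concat hyz).IsPath :=
    hp.concat (fun hmem => hz (hH.eq_penultimate_of_adj_end hp hyz hmem)) hyz
  have := hmax _ _ _ hpath
  rw [Walk.length_concat] at this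
  omega

lemma exists_isCycle_edges_subset [Finite W] {S : Set (Sym2 W)} (hS : S.Nonempty)
    (hSH : S ⊆ H.edgeSet) (h : ∀ e ∈ S, ∀ x ∈ e, ∃ e' ∈ S, e' ≠ e ∧ x ∈ e') :
    ∃ (v : W) (d : H.Walk v v), d.IsCycle ∧ ∀ e ∈ d.edges, e ∈ S := by
  have hadj {x y : W} : (fromEdgeSet S).Adj x y ↔ s(x, y) ∈ S := by
    rw [fromEdgeSet_adj, and_iff_left_iff_imp]
    exact fun hxy => (hSH hxy).ne
  obtain ⟨⟨x, y⟩, hxy⟩ := hS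
  have hcyclic : ¬ (fromEdgeSet S).IsAcyclic := by
    refine not_isAcyclic_of_forall_exists_ne (hadj.2 hxy) fun x y hxy => ?_
    obtain ⟨_, he', hne, z, rfl⟩ := h _ (hadj.1 hxy) x (Sym2.mem_mk_left x y)
    exact ⟨z, fun hz => hne (hz ▸ rfl), hadj.2 he'⟩
  simp only [IsAcyclic, not_forall, not_not] at hcyclic
  obtain ⟨v, d, hd⟩ := hcyclic
  have hle : fromEdgeSet S ≤ H := fun x y hxy => hSH (hadj.1 hxy)
  refine ⟨v, d.mapLe hle, hd.mapLe hle, fun e he => ?_⟩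
  rw [Walk.edges_mapLe_eq_edges] at he
  exact (edgeSet_fromEdgeSet S ▸ d.edges_subset_edgeSet he).1

end Cycles

section SubdivisionCycles

open SimpleGraph

variable {V I : Type*} {ends : I → V × V} {ℓ : I → ℕ} {i i' : I} {j a : ℕ}

lemma exists_walk_node (hends : ∀ i, (ends i).1 ≠ (ends i).2) :
    ∀ j ≤ ℓ i, ∃ w : (subdivision ends ℓ).Walk (node ends ℓ i 0) (node ends ℓ i j),
      w.support = (List.range (j + 1)).map (node ends ℓ i) ∧
        w.edges = (List.range j).map (nodeEdge ends ℓ i)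
  | 0, _ => ⟨Walk.nil, rfl, rfl⟩
  | j + 1, hj => by
    obtain ⟨w, hw, hw'⟩ := exists_walk_node hends j (Nat.le_of_succ_le hj)
    refine ⟨w.concat (node_adj_node_succ hends hj), ?_, ?_⟩
    · rw [Walk.support_concat, hw, List.range_succ (n := j + 1), List.map_append]
      rfl
    · rw [Walk.edges_concat, hw', List.range_succ (n := j), List.map_append, List.concat_eq_append]
      rfl

lemma exists_isPath_subdivision (hends : ∀ i, (ends i).1 ≠ (ends i).2) (hi : 0 < ℓ i) {x : V × V}
    (hx : ends i = x) :
    ∃ p : (subdivision ends ℓ).Walk (Sum.inl x.1) (Sum.inl x.2), p.IsPath ∧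
      p.edges = (List.range (ℓ i)).map (nodeEdge ends ℓ i) := by
  obtain ⟨w, hw, hw'⟩ := exists_walk_node hends (ℓ i) le_rfl
  subst hx
  refine ⟨w.copy (node_zero i) (node_length hi), ?_, by rw [Walk.edges_copy, hw']⟩
  rw [Walk.isPath_copy, Walk.isPath_def, hw]
  refine List.nodup_range.map_on fun j hj j' hj' he => node_injOn (hends i) ?_ ?_ he
  · exact Nat.lt_succ_iff.1 (List.mem_range.1 hj)
  · exact Nat.lt_succ_iff.1 (List.mem_range.1 hj')

lemma exists_isCycle_of_parallel (hends : ∀ i, (ends i).1 ≠ (ends i).2) (hℓ : ∀ i, 2 ≤ ℓ i)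
    (hne : i ≠ i') (hpar : ends i = ends i') :
    ∃ (x : SubdivVert V ℓ) (c : (subdivision ends ℓ).Walk x x), c.IsCycle ∧
      c.length ≤ ℓ i + ℓ i' ∧
      ∀ e ∈ c.edges, ∃ k, (k = i ∨ k = i') ∧ ∃ j < ℓ k, nodeEdge ends ℓ k j = e := by
  obtain ⟨p, hp, hpe⟩ := exists_isPath_subdivision hends (two_pos.trans_le (hℓ i)) hpar
  obtain ⟨q, hq, hqe⟩ := exists_isPath_subdivision hends (two_pos.trans_le (hℓ i')) rfl
  have hpq : p ≠ q := by
    rintro rfl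
    have h0 : 0 < ℓ i := two_pos.trans_le (hℓ i)
    have hmem : nodeEdge ends ℓ i 0 ∈ p.edges :=
      hpe ▸ List.mem_map_of_mem (List.mem_range.2 h0)
    obtain ⟨j, hj, he⟩ := List.mem_map.1 (hqe ▸ hmem)
    exact hne (nodeEdge_inj (hℓ i) (hends i) h0 (List.mem_range.1 hj) he).1.symm
  obtain ⟨x, y, p', q', hp', hq', hc⟩ := hp.exists_isCycle_of_ne hq hpq
  refine ⟨x, _, hc, ?_, fun e he => ?_⟩
  · rw [Walk.length_append, Walk.length_reverse]
    have hpl' := hp'.edges_isInfix.length_le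
    have hql' := hq'.edges_isInfix.length_le
    simp only [hpe, hqe, Walk.length_edges, List.length_map, List.length_range] at hpl' hql'
    exact add_le_add hpl' hql'
  · rw [Walk.edges_append, Walk.edges_reverse, List.mem_append, List.mem_reverse] at he
    rcases he with he | he
    · obtain ⟨j, hj, rfl⟩ := List.mem_map.1 (hpe ▸ hp'.edges_subset he)
      exact ⟨i, Or.inl rfl, j, List.mem_range.1 hj, rfl⟩
    · obtain ⟨j, hj, rfl⟩ := List.mem_map.1 (hqe ▸ hq'.edges_subset he)
      exact ⟨i', Or.inr rfl, j, List.mem_range.1 hj, rfl⟩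

lemma inl_mem_nodeEdge (hi : 2 ≤ ℓ i) (hj : j < ℓ i) {v : V} :
    Sum.inl v ∈ nodeEdge ends ℓ i j ↔
      j = 0 ∧ v = (ends i).1 ∨ j + 1 = ℓ i ∧ v = (ends i).2 := by
  simp only [nodeEdge, Sym2.mem_iff, node, Set.mem_Ioo]
  grind

variable {x : SubdivVert V ℓ} {c : (subdivision ends ℓ).Walk x x}

/- An inner vertex of the path that replaces an edge has degree two, so a cycle that enters the path
runs through all of it. -/
lemma nodeEdge_mem_edges_iff_zero (hends : ∀ i, (ends i).1 ≠ (ends i).2) (hc : c.IsCycle) :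
    ∀ j < ℓ i, (nodeEdge ends ℓ i j ∈ c.edges ↔ nodeEdge ends ℓ i 0 ∈ c.edges)
  | 0, _ => Iff.rfl
  | j + 1, hj => by
    rw [← nodeEdge_mem_edges_iff_zero hends hc j (Nat.lt_of_succ_lt hj)]
    have hinner : j + 1 ∈ Set.Ioo 0 (ℓ i) := ⟨j.succ_pos, hj⟩
    have hother {e : Sym2 (SubdivVert V ℓ)} (he : e ∈ c.edges) (hmem : node ends ℓ i (j + 1) ∈ e) :
        ∃ k, (k = j ∨ k = j + 1) ∧ nodeEdge ends ℓ i k ≠ e ∧ nodeEdge ends ℓ i k ∈ c.edges := by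
      obtain ⟨e', he', hne, hmem'⟩ := exists_mem_edges_ne hc he hmem
      obtain ⟨i', k, -, rfl⟩ := (mem_edgeSet_subdivision hends).1 (c.edges_subset_edgeSet he')
      rcases Sym2.mem_iff.1 hmem' with h | h
      · obtain ⟨rfl, rfl⟩ := eq_of_node_eq_node hinner h.symm
        exact ⟨_, Or.inr rfl, hne, he'⟩
      · obtain ⟨rfl, hk⟩ := eq_of_node_eq_node hinner h.symm
        exact ⟨k, Or.inl (Nat.succ_injective hk), hne, he'⟩
    constructor <;> intro h
    · obtain ⟨k, rfl | rfl, hne, hk⟩ := hother h (Sym2.mem_mk_left _ _)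
      exacts [hk, absurd rfl hne]
    · obtain ⟨k, rfl | rfl, hne, hk⟩ := hother h (Sym2.mem_mk_right _ _)
      exacts [absurd rfl hne, hk]

lemma sum_le_length (hends : ∀ i, (ends i).1 ≠ (ends i).2) (hℓ : ∀ i, 2 ≤ ℓ i) (hc : c.IsCycle)
    {S : Finset I} (hS : ∀ i ∈ S, nodeEdge ends ℓ i 0 ∈ c.edges) : ∑ i ∈ S, ℓ i ≤ c.length := by
  classical
  rw [← Walk.length_edges, ← List.toFinset_card_of_nodup hc.edges_nodup]
  calc ∑ i ∈ S, ℓ i = (S.sigma fun i => Finset.range (ℓ i)).card := by simp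
    _ ≤ c.edges.toFinset.card := by
      refine Finset.card_le_card_of_injOn (fun y => nodeEdge ends ℓ y.1 y.2) ?_ ?_
      · rintro ⟨i, j⟩ hy
        obtain ⟨hi, hj⟩ := Finset.mem_sigma.1 hy
        exact List.mem_toFinset.2
          ((nodeEdge_mem_edges_iff_zero hends hc j (Finset.mem_range.1 hj)).2 (hS i hi))
      · rintro ⟨i, j⟩ hy ⟨i', j'⟩ hy' he
        obtain ⟨rfl, rfl⟩ := nodeEdge_inj (hℓ i') (hends i')
          (Finset.mem_range.1 (Finset.mem_sigma.1 hy').2)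
          (Finset.mem_range.1 (Finset.mem_sigma.1 hy).2) he
        rfl

lemma length_eq_of_parallel (hends : ∀ i, (ends i).1 ≠ (ends i).2) (hℓ : ∀ i, 2 ≤ ℓ i)
    (hc : c.IsCycle) (hne : i ≠ i') (hpar : ends i = ends i')
    (hi : nodeEdge ends ℓ i 0 ∈ c.edges) (hi' : nodeEdge ends ℓ i' 0 ∈ c.edges) :
    c.length = ℓ i + ℓ i' := by
  classical
  obtain ⟨y, d, hd, hdl, hde⟩ := exists_isCycle_of_parallel hends hℓ hne hpar
  have hdc : d.length = c.length := length_eq_of_edges_subset hc hd fun e he => by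
    obtain ⟨k, rfl | rfl, j, hj, rfl⟩ := hde e he
    exacts [(nodeEdge_mem_edges_iff_zero hends hc j hj).2 hi,
      (nodeEdge_mem_edges_iff_zero hends hc j hj).2 hi']
  refine le_antisymm (hdc ▸ hdl) ?_
  rw [← Finset.sum_pair hne]
  exact sum_le_length hends hℓ hc (by simp [hi, hi'])

lemma exists_nodeEdge_mem_edges (hends : ∀ i, (ends i).1 ≠ (ends i).2) (hc : c.IsCycle)
    {e : Sym2 (SubdivVert V ℓ)} (he : e ∈ c.edges) :
    ∃ i, nodeEdge ends ℓ i 0 ∈ c.edges ∧ ∃ j < ℓ i, nodeEdge ends ℓ i j = e := by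
  obtain ⟨i, j, hj, rfl⟩ := (mem_edgeSet_subdivision hends).1 (c.edges_subset_edgeSet he)
  exact ⟨i, (nodeEdge_mem_edges_iff_zero hends hc j hj).1 he, j, hj, rfl⟩

lemma exists_ends_ne (hends : ∀ i, (ends i).1 ≠ (ends i).2) (hℓ : ∀ i, 2 ≤ ℓ i) (hc : c.IsCycle)
    (hinj : Set.InjOn (fun i => s((ends i).1, (ends i).2)) {i | nodeEdge ends ℓ i 0 ∈ c.edges})
    (hi : nodeEdge ends ℓ i 0 ∈ c.edges) {v : V} (hv : v ∈ s((ends i).1, (ends i).2)) :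
    ∃ i', nodeEdge ends ℓ i' 0 ∈ c.edges ∧
      s((ends i').1, (ends i').2) ≠ s((ends i).1, (ends i).2) ∧
      v ∈ s((ends i').1, (ends i').2) := by
  have hi2 := hℓ i
  obtain ⟨j, hj, hvj⟩ : ∃ j < ℓ i, Sum.inl v ∈ nodeEdge ends ℓ i j := by
    rcases Sym2.mem_iff.1 hv with rfl | rfl
    · exact ⟨0, by omega, (inl_mem_nodeEdge hi2 (by omega)).2 (Or.inl ⟨rfl, rfl⟩)⟩
    · exact ⟨ℓ i - 1, by omega, (inl_mem_nodeEdge hi2 (by omega)).2 (Or.inr ⟨by omega, rfl⟩)⟩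
  obtain ⟨e, he, hne, hve⟩ :=
    exists_mem_edges_ne hc ((nodeEdge_mem_edges_iff_zero hends hc j hj).2 hi) hvj
  obtain ⟨i', hi', j', hj', rfl⟩ := exists_nodeEdge_mem_edges hends hc he
  rw [inl_mem_nodeEdge (hℓ _) ‹_›] at hvj hve
  refine ⟨i', hi', fun h => ?_, ?_⟩
  · obtain rfl := hinj hi' hi h
    have := hends i'
    grind
  · rw [Sym2.mem_iff]
    tauto

lemma exists_isCycle_length_mul_le [Finite V] {G : SimpleGraph V}
    (hG : ∀ i, G.Adj (ends i).1 (ends i).2) (hℓ : ∀ i, 2 ≤ ℓ i) (ha : ∀ i, a ≤ ℓ i)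
    (hc : c.IsCycle)
    (hinj : Set.InjOn (fun i => s((ends i).1, (ends i).2)) {i | nodeEdge ends ℓ i 0 ∈ c.edges}) :
    ∃ (v : V) (d : G.Walk v v), d.IsCycle ∧ d.length * a ≤ c.length := by
  classical
  have hends i : (ends i).1 ≠ (ends i).2 := (hG i).ne
  obtain ⟨i₀, hi₀, -⟩ :=
    exists_nodeEdge_mem_edges hends hc (c.mk_start_snd_mem_edges hc.not_nil)
  obtain ⟨v, d, hd, hdU⟩ := exists_isCycle_edges_subset (H := G)
    (S := (fun i => s((ends i).1, (ends i).2)) '' {i | nodeEdge ends ℓ i 0 ∈ c.edges})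
    ⟨_, i₀, hi₀, rfl⟩ (Set.image_subset_iff.2 fun i _ => hG i) (by
      rintro _ ⟨i, hi, rfl⟩ v hv
      obtain ⟨i', hi', hne, hv'⟩ := exists_ends_ne hends hℓ hc hinj hi hv
      exact ⟨_, ⟨i', hi', rfl⟩, hne, hv'⟩)
  refine ⟨v, d, hd, ?_⟩
  obtain ⟨S, hS, hSd⟩ := Finset.subset_set_image_iff.1
    (show (d.edges.toFinset : Set (Sym2 V)) ⊆ _ from fun e he => hdU e (List.mem_toFinset.1 he))
  calc d.length * a = d.edges.toFinset.card * a := by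
        rw [List.toFinset_card_of_nodup hd.edges_nodup, Walk.length_edges]
    _ ≤ S.card * a := Nat.mul_le_mul_right a (hSd ▸ Finset.card_image_le)
    _ ≤ ∑ i ∈ S, ℓ i := by
        rw [← smul_eq_mul]
        exact S.card_nsmul_le_sum ℓ a fun i _ => ha i
    _ ≤ c.length := sum_le_length hends hℓ hc hS

end SubdivisionCycles

section OddReplacement

open SimpleGraph

variable {V : Type*} {G : SimpleGraph V} {a : ℕ}

/-- The lengths of the two paths that replace an edge in `oddReplacement`. -/
def oddLength (G : SimpleGraph V) (a : ℕ) (i : G.edgeSet × Bool) : ℕ := a + i.2.toNat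

/-- The ends of the two paths that replace an edge in `oddReplacement`, in an arbitrary order. -/
noncomputable def oddEnds (G : SimpleGraph V) (i : G.edgeSet × Bool) : V × V := i.1.1.out

/-- The graph obtained from `G` by replacing each edge by a cycle of length `2 * a + 1` on which the
ends of the edge have distance `a`. -/
noncomputable def oddReplacement (G : SimpleGraph V) (a : ℕ) :
    SimpleGraph (SubdivVert V (oddLength G a)) :=
  subdivision (oddEnds G) (oddLength G a)

lemma le_oddLength (i : G.edgeSet × Bool) : a ≤ oddLength G a i := Nat.le_add_right _ _

lemma oddLength_add_oddLength {i i' : G.edgeSet × Bool} (h : i.1 = i'.1) (hne : i ≠ i') :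
    oddLength G a i + oddLength G a i' = 2 * a + 1 := by
  obtain ⟨e, b⟩ := i
  obtain ⟨e', b'⟩ := i'
  obtain rfl : e = e' := h
  have hb : b.toNat + b'.toNat = 1 := by
    cases b <;> cases b' <;> first | rfl | exact absurd rfl hne
  simp only [oddLength]
  omega

lemma mk_oddEnds (i : G.edgeSet × Bool) : s((oddEnds G i).1, (oddEnds G i).2) = i.1.1 :=
  Quot.out_eq _

lemma adj_oddEnds (i : G.edgeSet × Bool) : G.Adj (oddEnds G i).1 (oddEnds G i).2 := by
  rw [← mem_edgeSet, mk_oddEnds]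
  exact i.1.2

lemma IsPlanar.oddReplacement [Finite V] (hG : IsPlanar G) (ha : 2 ≤ a) :
    IsPlanar (oddReplacement G a) := by
  obtain ⟨D⟩ := hG
  obtain ⟨D', hD'⟩ := D.exists_multiDrawing (a + 1)
  obtain ⟨D'', hD''⟩ := D'.exists_doubled fun e => (by omega : 2 ≤ a + 1).trans (hD' e)
  refine D''.isPlanar_subdivision (fun i => ha.trans (le_oddLength i)) (fun i => ?_)
    fun i => (adj_oddEnds i).ne
  rw [hD'']
  exact (Nat.add_le_add_left i.2.toNat_le a).trans (hD' i.1)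

lemma length_eq_or_mul_le_length [Finite V] (ha : 2 ≤ a) {g : ℕ} (hg : g ≤ G.egirth)
    {x : SubdivVert V (oddLength G a)} {c : (oddReplacement G a).Walk x x} (hc : c.IsCycle) :
    c.length = 2 * a + 1 ∨ g * a ≤ c.length := by
  have hℓ (i : G.edgeSet × Bool) : 2 ≤ oddLength G a i := ha.trans (le_oddLength i)
  by_cases hinj : Set.InjOn (fun i => s((oddEnds G i).1, (oddEnds G i).2))
    {i | nodeEdge (oddEnds G) (oddLength G a) i 0 ∈ c.edges}
  · obtain ⟨v, d, hd, hdc⟩ := exists_isCycle_length_mul_le adj_oddEnds hℓ le_oddLength hc hinj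
    exact Or.inr ((Nat.mul_le_mul_right a (by exact_mod_cast le_egirth.1 hg v d hd)).trans hdc)
  · simp only [Set.InjOn, mk_oddEnds, not_forall] at hinj
    obtain ⟨i, hi, i', hi', he, hne⟩ := hinj
    rw [← oddLength_add_oddLength (Subtype.ext he) hne]
    exact Or.inl (length_eq_of_parallel (fun i => (adj_oddEnds i).ne) hℓ hc hne
      (congrArg Quot.out he) hi hi')

lemma egirth_oddReplacement [Finite V] (ha : 2 ≤ a) (e : G.edgeSet) :
    (oddReplacement G a).egirth = (2 * a + 1 : ℕ) := by
  refine le_antisymm ?_ (le_egirth.2 fun x c hc => ?_)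
  · have hne : ((e, false) : G.edgeSet × Bool) ≠ (e, true) := by simp
    obtain ⟨x, c, hc, hcl, -⟩ := exists_isCycle_of_parallel (fun i => (adj_oddEnds i).ne)
      (fun i => ha.trans (le_oddLength i)) hne rfl
    rw [oddLength_add_oddLength (i := (e, false)) (i' := (e, true)) rfl hne] at hcl
    exact (egirth_le_length hc).trans (by exact_mod_cast hcl)
  · have hg : ((3 : ℕ) : ℕ∞) ≤ G.egirth := by exact_mod_cast G.three_le_egirth
    rcases length_eq_or_mul_le_length ha hg hc with h | h
    · exact_mod_cast h.ge
    · exact_mod_cast (by omega : 2 * a + 1 ≤ c.length)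

end OddReplacement

section Colorings

open SimpleGraph

variable {V : Type*} {G : SimpleGraph V} {a : ℕ}

lemma cycleColorable_iff_zmod {k : ℕ} (hk : 2 ≤ k) :
    CycleColorable G k ↔ ∃ φ : V → ZMod k, ∀ u v, G.Adj u v → φ v - φ u = 1 ∨ φ v - φ u = -1 := by
  obtain ⟨n, rfl⟩ := Nat.exists_eq_add_of_le' hk
  have hadj {x y : ZMod (n + 2)} :
      (cycleGraph (n + 2)).Adj x y ↔ y - x = 1 ∨ y - x = -1 := by
    rw [← neg_sub x y, neg_inj, neg_sub, or_comm]
    exact Iff.rfl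
  exact ⟨fun ⟨φ⟩ => ⟨φ, fun u v huv => hadj.1 (φ.map_adj huv)⟩,
    fun ⟨φ, hφ⟩ => ⟨φ, fun huv => hadj.2 (hφ _ _ huv)⟩⟩

lemma exists_node_sub_node_zero_eq {R I : Type*} [CommRing R] {ends : I → V × V} {ℓ : I → ℕ}
    (hends : ∀ i, (ends i).1 ≠ (ends i).2) {φ : SubdivVert V ℓ → R}
    (hφ : ∀ x y, (subdivision ends ℓ).Adj x y → φ y - φ x = 1 ∨ φ y - φ x = -1) (i : I) :
    ∀ j ≤ ℓ i, ∃ k ≤ j, φ (node ends ℓ i j) - φ (node ends ℓ i 0) = j - 2 * k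
  | 0, _ => ⟨0, le_rfl, by simp⟩
  | j + 1, hj => by
    obtain ⟨k, hk, he⟩ := exists_node_sub_node_zero_eq hends hφ i j (Nat.le_of_succ_le hj)
    rcases hφ _ _ (node_adj_node_succ hends hj) with h | h
    · exact ⟨k, by omega, by push_cast; linear_combination he + h⟩
    · exact ⟨k + 1, by omega, by push_cast; linear_combination he + h⟩

lemma eq_zero_or_eq_of_dvd {k k' : ℕ} (hk : k ≤ a) (hk' : k' ≤ a + 1)
    (h : (2 * a + 1 : ℤ) ∣ 1 - 2 * k' + 2 * k) : k = 0 ∨ k = a := by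
  obtain ⟨q, hq⟩ := h
  have h1 : q < 2 := by
    by_contra! hcon
    nlinarith
  have h2 : -2 < q := by
    by_contra! hcon
    nlinarith
  rcases (by omega : q = -1 ∨ q = 0 ∨ q = 1) with rfl | rfl | rfl <;> omega

lemma ends_sub_eq_of_oddReplacement (ha : 0 < a)
    {φ : SubdivVert V (oddLength G a) → ZMod (2 * a + 1)}
    (hφ : ∀ x y, (oddReplacement G a).Adj x y → φ y - φ x = 1 ∨ φ y - φ x = -1) (e : G.edgeSet) :
    φ (Sum.inl e.1.out.2) - φ (Sum.inl e.1.out.1) = a ∨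
      φ (Sum.inl e.1.out.2) - φ (Sum.inl e.1.out.1) = -a := by
  have hpath (b : Bool) : ∃ k ≤ a + b.toNat,
      φ (Sum.inl e.1.out.2) - φ (Sum.inl e.1.out.1) = (a + b.toNat : ℕ) - 2 * k := by
    have := exists_node_sub_node_zero_eq (fun i => (adj_oddEnds i).ne) hφ (e, b) _ le_rfl
    rwa [node_zero, node_length (ha.trans_le (le_oddLength _))] at this
  obtain ⟨k, hk, he⟩ := hpath false
  obtain ⟨k', hk', he'⟩ := hpath true
  have hdvd : (2 * a + 1 : ℤ) ∣ 1 - 2 * k' + 2 * k := by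
    have : ((2 * a + 1 : ℕ) : ℤ) ∣ 1 - 2 * k' + 2 * k := by
      rw [← ZMod.intCast_zmod_eq_zero_iff_dvd]
      push_cast [Bool.toNat_true, Bool.toNat_false] at he he' ⊢
      linear_combination he - he'
    exact_mod_cast this
  rw [he, Bool.toNat_false, add_zero]
  rcases eq_zero_or_eq_of_dvd hk hk' hdvd with rfl | rfl
  · left
    simp
  · right
    ring

lemma cycleColorable_of_oddReplacement (ha : 0 < a)
    (h : CycleColorable (oddReplacement G a) (2 * a + 1)) : CycleColorable G (2 * a + 1) := by
  rw [cycleColorable_iff_zmod (by omega)] at h ⊢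
  obtain ⟨φ, hφ⟩ := h
  have hp : (2 * a + 1 : ZMod (2 * a + 1)) = 0 := by
    exact_mod_cast ZMod.natCast_self (2 * a + 1)
  -- As `-2 * a = 1` in `ZMod (2 * a + 1)`, multiplication by `-2` turns differences `±a` into `±1`.
  refine ⟨fun v => -2 * φ (Sum.inl v), fun u v huv => ?_⟩
  have hsub := ends_sub_eq_of_oddReplacement ha hφ ⟨s(u, v), huv⟩
  have hout : s(s(u, v).out.1, s(u, v).out.2) = s(u, v) := Quot.out_eq _
  rcases Sym2.eq_iff.1 hout with ⟨h1, h2⟩ | ⟨h1, h2⟩ <;> rw [h1, h2] at hsub <;>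
    rcases hsub with h | h
  · left; linear_combination -2 * h - hp
  · right; linear_combination -2 * h + hp
  · right; linear_combination 2 * h + hp
  · left; linear_combination 2 * h - hp

lemma abs_val_sub_val_of_sub_eq {x y : ZMod (2 * a + 1)} (h : x - y = a) :
    (a : ℤ) ≤ |(x.val : ℤ) - y.val| ∧ |(x.val : ℤ) - y.val| ≤ (2 * a + 1 : ℕ) - a := by
  obtain rfl : x = y + a := by rw [← h, add_sub_cancel]
  have hval : (a : ZMod (2 * a + 1)).val = a := ZMod.val_natCast_of_lt (by omega)
  rw [le_abs, abs_le]
  rcases lt_or_ge (y.val + (a : ZMod (2 * a + 1)).val) (2 * a + 1) with hlt | hge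
  · rw [ZMod.val_add_of_lt hlt]
    omega
  · have := ZMod.val_add_val_of_le hge
    omega

lemma CycleColorable.hasCircularColoring (ha : 0 < a) (h : CycleColorable G (2 * a + 1)) :
    HasCircularColoring G (2 * a + 1) a := by
  obtain ⟨φ, hφ⟩ := (cycleColorable_iff_zmod (by omega)).1 h
  obtain ⟨θ, hθ⟩ : ∃ θ : V → ZMod (2 * a + 1),
      ∀ u v, G.Adj u v → θ v - θ u = a ∨ θ u - θ v = a := by
    refine ⟨fun v => a * φ v, fun u v huv => (hφ u v huv).imp (fun h => ?_) fun h => ?_⟩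
    · rw [← mul_sub, h, mul_one]
    · rw [← mul_sub, ← neg_sub, h, neg_neg, mul_one]
  refine ⟨fun v => ⟨(θ v).val, ZMod.val_lt _⟩, fun u v huv => ?_⟩
  rcases hθ u v huv with h | h
  · rw [abs_sub_comm]
    exact abs_val_sub_val_of_sub_eq h
  · exact abs_val_sub_val_of_sub_eq h

lemma circularChromaticNumber_le {k d : ℕ} (hd : 0 < d) (hk : 2 * d ≤ k)
    (h : HasCircularColoring G k d) : circularChromaticNumber G ≤ (k : ℝ) / d := by
  refine csInf_le ⟨0, ?_⟩ ⟨k, d, hd, hk, h, rfl⟩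
  rintro _ ⟨k, d, -, -, -, rfl⟩
  positivity

end Colorings

section GirthBound

open SimpleGraph

lemma IsPlanar.of_isContained {V V' : Type*} {G : SimpleGraph V} {G' : SimpleGraph V'}
    (hG : IsPlanar G) (h : G' ⊑ G) : IsPlanar G' := by
  obtain ⟨D⟩ := hG
  obtain ⟨φ, hφ⟩ := h
  have hedge (e) (he : e ∈ G'.edgeSet) : Sym2.map φ e ∈ G.edgeSet := φ.map_mem_edgeSet he
  exact ⟨{
    pt := D.pt ∘ φ
    arc := D.arc ∘ Sym2.map φ
    pt_injective := D.pt_injective.comp hφ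
    isPolygonalArc := fun u v huv => D.isPolygonalArc _ _ (φ.map_adj huv)
    mem_of_pt_mem := fun e he w hw => by
      obtain ⟨w', hw', h⟩ := Sym2.mem_map.1 (D.mem_of_pt_mem _ (hedge e he) _ hw)
      exact hφ h ▸ hw'
    inter_subset := fun e he e' he' hne z hz => by
      obtain ⟨_, hw, hw', rfl⟩ := D.inter_subset _ (hedge e he) _ (hedge e' he')
        (fun h => hne (Sym2.map.injective hφ h)) z hz
      obtain ⟨x, hx, rfl⟩ := Sym2.mem_map.1 hw
      obtain ⟨y, hy, h⟩ := Sym2.mem_map.1 hw'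
      exact ⟨x, hx, hφ h ▸ hy, rfl⟩ }⟩

lemma exists_isSteinbergBound {k m : ℕ} (h : f k ≤ m) : ∃ m' ≤ m, IsSteinbergBound k m' := by
  have hlt : f k < (m + 1 : ℕ) := h.trans_lt (by exact_mod_cast m.lt_succ_self)
  obtain ⟨m', hlt⟩ := iInf_lt_iff.1 hlt
  obtain ⟨hm', hlt⟩ := iInf_lt_iff.1 hlt
  exact ⟨m', Nat.lt_succ_iff.1 (by exact_mod_cast hlt), hm'⟩

lemma IsSteinbergBound.cycleColorable {V : Type} [Finite V] {G : SimpleGraph V} {a m g : ℕ}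
    (hb : IsSteinbergBound (2 * a + 1) m) (ha : 2 ≤ a) (hm : m < g * a) (hG : IsPlanar G)
    (hg : g ≤ G.egirth) : CycleColorable G (2 * a + 1) := by
  rcases isEmpty_or_nonempty G.edgeSet with hE | ⟨⟨e⟩⟩
  · exact ⟨⟨fun _ => 0, fun {u v} huv => hE.elim ⟨s(u, v), huv⟩⟩⟩
  refine cycleColorable_of_oddReplacement (two_pos.trans_le ha) ?_
  refine hb _ _ (hG.oddReplacement ha) (egirth_oddReplacement ha e) fun x c hc hl => ?_
  rcases length_eq_or_mul_le_length ha hg hc with h | h <;> omega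

lemma cycleColorable_of_forall_fin {V : Type*} {G : SimpleGraph V} {k : ℕ}
    (h : ∀ (n : ℕ) (G' : SimpleGraph (Fin n)), G' ⊑ G → CycleColorable G' k) :
    CycleColorable G k := by
  refine nonempty_hom_of_forall_finite_subgraph_hom fun G' hG' => Nonempty.some ?_
  have : Finite G'.verts := hG'
  obtain ⟨n, ⟨e⟩⟩ := Finite.exists_equiv_fin G'.verts
  have iso : G'.coe.comap e.symm ≃g G'.coe := Iso.comap e.symm G'.coe
  obtain ⟨φ⟩ := h n _ (IsContained.trans ⟨iso.toCopy⟩ G'.coe_isContained)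
  exact ⟨φ.comp iso.symm.toHom⟩

end GirthBound

end SteinbergCircular

open SteinbergCircular in
theorem proposition1p5_general (p : ℕ) (hp : Odd p) (hp5 : 5 ≤ p)
    (hf : f p ≤ ((p * (p - 2) : ℕ) : ℕ∞)) {V : Type*} (G : SimpleGraph V) (hG : IsPlanar G)
    (hgirth : ((2 * p - 2 : ℕ) : ℕ∞) ≤ G.egirth) :
    CycleColorable G p ∧ circularChromaticNumber G ≤ 2 + 2 / ((p : ℝ) - 1) := by
  obtain ⟨a, rfl⟩ := hp
  have ha : 2 ≤ a := by omega
  obtain ⟨m, hm, hb⟩ := exists_isSteinbergBound hf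
  have hma : m < (2 * (2 * a + 1) - 2) * a := by
    obtain ⟨b, rfl⟩ := Nat.exists_eq_add_of_le' ha
    refine hm.trans_lt ?_
    rw [show 2 * (b + 2) + 1 - 2 = 2 * b + 3 by omega,
      show 2 * (2 * (b + 2) + 1) - 2 = 4 * b + 8 by omega]
    nlinarith
  have hcol : CycleColorable G (2 * a + 1) := cycleColorable_of_forall_fin fun n G' hG' =>
    hb.cycleColorable ha hma (hG.of_isContained hG') (hgirth.trans hG'.egirth_le)
  refine ⟨hcol, ?_⟩
  calc circularChromaticNumber G ≤ ((2 * a + 1 : ℕ) : ℝ) / a :=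
        circularChromaticNumber_le (by omega) (by omega) (hcol.hasCircularColoring (by omega))
    _ = 2 + 2 / (((2 * a + 1 : ℕ) : ℝ) - 1) := by
        have : (a : ℝ) ≠ 0 := by positivity
        push_cast
        field_simp
        ring

theorem proposition1p5 (p : ℕ) (hp : p.Prime) (hp5 : 5 ≤ p)
    (hf : SteinbergCircular.f p ≤ ((p * (p - 2) : ℕ) : ℕ∞))
    {V : Type*} [Finite V] (G : SimpleGraph V) (hG : SteinbergCircular.IsPlanar G)
    (hgirth : ((2 * p - 2 : ℕ) : ℕ∞) ≤ G.egirth) :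
    SteinbergCircular.CycleColorable G p ∧
      SteinbergCircular.circularChromaticNumber G ≤ 2 + 2 / ((p : ℝ) - 1) :=
  proposition1p5_general p (hp.odd_of_ne_two (by omega)) hp5 hf G hG hgirth
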